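/- Let $k$ be a field of characteristic $p>0$ with $[k:k^p]<\infty$, let $n\ge 0$, let $R=k[x_0,\dots,x_n]$ with its standard grading, let $\mathfrak m=(x_0,\dots,x_n)$, and let $f\in R$ be homogeneous of degree $d$. A ring $A$ of characteristic $p$ is called F-pure if its Frobenius map $F:A\to A$, $a\mapsto a^p$, is pure, i.e. remains injective after tensoring with any $A$-module (the zero ring counts as F-pure). We say that $R/fR$ has an isolated non-F-pure point at $\mathfrak m$ if $(R/fR)_{\mathfrak m}$ is not F-pure but $(R/fR)_{\mathfrak p}$ is F-pure for every prime ideal $\mathfrak p\subsetneq\mathfrak m$ of $R$. The local cohomology module $H^n_{\mathfrak m}(R/fR)$ carries the $\mathbb Z$-grading and the Frobenius action $F$ induced by the grading and the Frobenius map of $R/fR$ (computed on the Čech complex of $R/fR$ on $x_0,\dots,x_n$); for $N\in\mathbb Z$ let $H^n_{\mathfrak m}(R/fR)_{\le N}$ be the sum of its components of degree $\le N$. Assume that $(R/fR)_{\mathfrak m}$ is not F-pure. Then $R/fR$ has an isolated non-F-pure point at $\mathfrak m$ if and only if the Frobenius action $$F: H^n_{\mathfrak m}(R/fR)_{\le -n(d-1)}\longrightarrow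 H^n_{\mathfrak m}(R/fR)_{\le -pn(d-1)}$$ is injective. -/

import Mathlib

open scoped TensorProduct

universe u

/-! ### The Frobenius map and F-purity -/

/-- A ring homomorphism `φ : A → B` is pure if `M → B ⊗_A M`, `m ↦ 1 ⊗ m`, is injective for every
`A`-module `M`. -/
def RingHomIsPure {A B : Type u} [CommRing A] [CommRing B] (φ : A →+* B) : Prop :=
  letI : Algebra A B := φ.toAlgebra
  ∀ (M : Type u) [AddCommGroup M] [Module A M],
    Function.Injective (fun m : M => (1 : B) ⊗ₜ[A] m)

theorem add_pow_prime_of_algebra (k : Type*) [Field k] (p : ℕ) [Fact p.Prime] [CharP k p]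
    {A : Type*} [CommRing A] [Algebra k A] (a b : A) : (a + b) ^ p = a ^ p + b ^ p := by
  rcases subsingleton_or_nontrivial A with h | h
  · exact Subsingleton.elim _ _
  · have : CharP A p := charP_of_injective_algebraMap (algebraMap k A).injective p
    exact add_pow_char a b p

/-- The Frobenius map `a ↦ a ^ p` of an algebra over a field of characteristic `p`
(the zero ring is allowed). -/
def frobeniusOver (k : Type*) [Field k] (p : ℕ) [Fact p.Prime] [CharP k p]
    (A : Type*) [CommRing A] [Algebra k A] : A →+* A where
  toFun a := a ^ p
  map_one' := one_pow p
  map_mul' a b := mul_pow a b p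
  map_zero' := zero_pow (Fact.out : p.Prime).ne_zero
  map_add' a b := add_pow_prime_of_algebra k p a b

/-- `A` is F-pure if its Frobenius map is pure. -/
def IsFPure (k : Type u) [Field k] (p : ℕ) [Fact p.Prime] [CharP k p]
    (A : Type u) [CommRing A] [Algebra k A] : Prop :=
  RingHomIsPure (frobeniusOver k p A)

/-! ### Čech complexes and local cohomology -/

namespace Cech

section Complex

variable {A : Type*} [CommRing A] {m : ℕ} (x : Fin m → A)

/-- The localization `A_{x_I}`, where `x_I` is the product of the `x_j` with `j ∈ I`. -/
abbrev Loc (I : Finset (Fin m)) : Type _ := Localization.Away (∏ j ∈ I, x j)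

/-- The canonical map `A_{x_I} → A_{x_J}` for `I ⊆ J`. -/
noncomputable def res {I J : Finset (Fin m)} (h : I ⊆ J) : Loc x I →ₐ[A] Loc x J :=
  IsLocalization.liftAlgHom (M := Submonoid.powers (∏ j ∈ I, x j))
    (f := Algebra.ofId A (Loc x J)) (by
      rintro ⟨_, t, rfl⟩
      have h1 : IsUnit (algebraMap A (Loc x J) (∏ j ∈ J, x j)) :=
        IsLocalization.Away.algebraMap_isUnit _
      have h2 : IsUnit (algebraMap A (Loc x J) (∏ j ∈ I, x j)) :=
        isUnit_of_dvd_unit (map_dvd _ (Finset.prod_dvd_prod_of_subset I J x h)) h1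
      simpa [Algebra.ofId_apply] using h2.pow t)

/-- The Čech cochains of all degrees at once: the product of all `A_{x_I}`. The cochains of
degree `i` are those that are supported on the `I` with `i` elements. -/
abbrev Cochain : Type _ := ∀ I : Finset (Fin m), Loc x I

/-- The Čech differential:
`(d c)_J = ∑_{j ∈ J} (-1) ^ #{l ∈ J | l < j} • c_{J \ j}` (restricted to `A_{x_J}`). -/
noncomputable def d : Cochain x →ₗ[A] Cochain x where
  toFun c J := ∑ j ∈ J, (-1 : ℤ) ^ (J.filter (· < j)).card •
    res x (Finset.erase_subset j J) (c (J.erase j))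
  map_add' c c' := by
    funext J
    simp only [Pi.add_apply, map_add, smul_add, Finset.sum_add_distrib]
  map_smul' a c := by
    funext J
    simp only [Pi.smul_apply, map_smul, RingHom.id_apply, Finset.smul_sum]
    exact Finset.sum_congr rfl fun j _ => smul_comm _ _ _

/-- The cocycles of degree `i`. -/
noncomputable def cocycles (i : ℕ) : Submodule A (Cochain x) where
  carrier := {c | (∀ I, I.card ≠ i → c I = 0) ∧ d x c = 0}
  zero_mem' := ⟨fun _ _ => rfl, map_zero _⟩
  add_mem' {c c'} hc hc' :=
    ⟨fun I hI => by rw [Pi.add_apply, hc.1 I hI, hc'.1 I hI, add_zero],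
      by rw [map_add, hc.2, hc'.2, add_zero]⟩
  smul_mem' a c hc :=
    ⟨fun I hI => by rw [Pi.smul_apply, hc.1 I hI, smul_zero], by rw [map_smul, hc.2, smul_zero]⟩

/-- The coboundaries of degree `i`: the `d b` with `b` a cochain of degree `i - 1`
(so only `0` if `i = 0`). -/
noncomputable def coboundaries (i : ℕ) : Submodule A (Cochain x) where
  carrier := {c | ∃ b : Cochain x, (∀ I, I.card + 1 ≠ i → b I = 0) ∧ d x b = c}
  zero_mem' := ⟨0, fun _ _ => rfl, map_zero _⟩
  add_mem' := by
    rintro _ _ ⟨b, hb, rfl⟩ ⟨b', hb', rfl⟩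
    exact ⟨b + b', fun I hI => by rw [Pi.add_apply, hb I hI, hb' I hI, add_zero], map_add _ _ _⟩
  smul_mem' := by
    rintro a _ ⟨b, hb, rfl⟩
    exact ⟨a • b, fun I hI => by rw [Pi.smul_apply, hb I hI, smul_zero], map_smul _ _ _⟩

/-- The local cohomology module `H^i_{(x)}(A)`, as the cohomology of the Čech complex on `x`. -/
abbrev H (i : ℕ) : Type _ := cocycles x i ⧸ (coboundaries x i).comap (cocycles x i).subtype

end Complex

section Frobenius

variable (k : Type*) [Field k] (p : ℕ) [Fact p.Prime] [CharP k p]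
  {A : Type*} [CommRing A] [Algebra k A] {m : ℕ} (x : Fin m → A)

/-- Frobenius on Čech cochains: Frobenius of the ring `A_{x_I}` in each component. -/
noncomputable def frobCochain : Cochain x →ₛₗ[frobeniusOver k p A] Cochain x where
  toFun c I := frobeniusOver k p (Loc x I) (c I)
  map_add' c c' := by
    funext I
    exact map_add _ _ _
  map_smul' a c := by
    funext I
    exact smul_pow a (c I) p

theorem d_frobCochain (c : Cochain x) : d x (frobCochain k p x c) = frobCochain k p x (d x c) := by
  funext J
  change ∑ j ∈ J, (-1 : ℤ) ^ (J.filter (· < j)).card •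
      res x (Finset.erase_subset j J) ((c (J.erase j)) ^ p) =
    frobeniusOver k p (Loc x J) (∑ j ∈ J, (-1 : ℤ) ^ (J.filter (· < j)).card •
      res x (Finset.erase_subset j J) (c (J.erase j)))
  rw [map_sum]
  refine Finset.sum_congr rfl fun j _ => ?_
  rw [map_zsmul, map_pow]
  rfl

theorem frobCochain_eq_zero {c : Cochain x} {I : Finset (Fin m)} (h : c I = 0) :
    frobCochain k p x c I = 0 := by
  change frobeniusOver k p (Loc x I) (c I) = 0
  rw [h, map_zero]

/-- Frobenius on cocycles. -/
noncomputable def frobCocycles (i : ℕ) :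
    cocycles x i →ₛₗ[frobeniusOver k p A] cocycles x i :=
  (frobCochain k p x).restrict (p := cocycles x i) (q := cocycles x i) fun c hc =>
    ⟨fun I hI => frobCochain_eq_zero k p x (hc.1 I hI), by
      rw [d_frobCochain, hc.2, map_zero]⟩

/-- The Frobenius action on the local cohomology module `H^i_{(x)}(A)`. -/
noncomputable def frobH (i : ℕ) : H x i →ₛₗ[frobeniusOver k p A] H x i :=
  Submodule.mapQ _ _ (frobCocycles k p x i) (by
    rintro ⟨c, hc⟩ ⟨b, hb, hbc⟩
    refine ⟨frobCochain k p x b, fun I hI => frobCochain_eq_zero k p x (hb I hI), ?_⟩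
    rw [d_frobCochain, hbc]
    rfl)

end Frobenius

end Cech

/-! ### Hypersurfaces -/

namespace Hypersurface

open MvPolynomial

section Defs

variable {k : Type u} [Field k] {n : ℕ}

/-- The homogeneous maximal ideal `(x_0, …, x_n)` of `k[x_0, …, x_n]`. -/
noncomputable def maxIdeal (k : Type u) [Field k] (n : ℕ) : Ideal (MvPolynomial (Fin (n + 1)) k) :=
  Ideal.span (Set.range X)

/-- The ring `R/fR` with `R = k[x_0, …, x_n]`. -/
abbrev Quot (f : MvPolynomial (Fin (n + 1)) k) : Type u :=
  MvPolynomial (Fin (n + 1)) k ⧸ Ideal.span {f}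

instance isPrime_maxIdeal : (maxIdeal k n).IsPrime := by
  have h : maxIdeal k n = RingHom.ker (constantCoeff : MvPolynomial (Fin (n + 1)) k →+* k) := by
    ext g
    rw [maxIdeal, ← Set.image_univ, mem_ideal_span_X_image, RingHom.mem_ker, constantCoeff_eq]
    constructor
    · intro h
      by_contra h0
      obtain ⟨i, _, hi⟩ := h 0 (mem_support_iff.mpr h0)
      exact hi rfl
    · intro h s hs
      by_contra! hc
      have h0 : s = 0 := Finsupp.ext fun i => hc i (Set.mem_univ i)
      rw [h0] at hs
      exact mem_support_iff.mp hs h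
  rw [h]
  exact RingHom.ker_isPrime _

/-- The ring `(R/fR)_𝔭`, for `𝔭` a prime of `R` (it is the zero ring if `f ∉ 𝔭`). -/
abbrev LocAt (f : MvPolynomial (Fin (n + 1)) k) (P : Ideal (MvPolynomial (Fin (n + 1)) k))
    [P.IsPrime] : Type u :=
  Localization (Algebra.algebraMapSubmonoid (Quot f) P.primeCompl)

/-- `R/fR` has an isolated non-F-pure point at `𝔪`: `(R/fR)_𝔪` is not F-pure, but `(R/fR)_𝔭` is
F-pure for every prime `𝔭 ⊊ 𝔪`. -/
def HasIsolatedNonFPurePoint (p : ℕ) [Fact p.Prime] [CharP k p]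
    (f : MvPolynomial (Fin (n + 1)) k) : Prop :=
  ¬ IsFPure k p (LocAt f (maxIdeal k n)) ∧
    ∀ (P : Ideal (MvPolynomial (Fin (n + 1)) k)) [P.IsPrime], P < maxIdeal k n →
      IsFPure k p (LocAt f P)

variable (f : MvPolynomial (Fin (n + 1)) k)

/-- The images of the variables in `R/fR`. -/
noncomputable def var (j : Fin (n + 1)) : Quot f := Ideal.Quotient.mk (Ideal.span {f}) (X j)

/-- The part of degree `j` of `(R/fR)_{x_I}`: all fractions `g / x_I ^ t` with `g` a
homogeneous polynomial of degree `j + t * #I` (only `g = 0` if this integer is negative). -/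
noncomputable def locDeg (I : Finset (Fin (n + 1))) (j : ℤ) : Submodule k (Cech.Loc (var f) I) where
  carrier := {z | ∃ (t : ℕ) (g : MvPolynomial (Fin (n + 1)) k),
    IsWeightedHomogeneous (fun _ => (1 : ℤ)) g (j + t * I.card) ∧
    z * algebraMap (Quot f) (Cech.Loc (var f) I) (∏ l ∈ I, var f l) ^ t =
      algebraMap (Quot f) (Cech.Loc (var f) I) (Ideal.Quotient.mk (Ideal.span {f}) g)}
  zero_mem' := ⟨0, 0, isWeightedHomogeneous_zero _ _ _, by simp⟩
  add_mem' := by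
    rintro z z' ⟨t, g, hg, h⟩ ⟨t', g', hg', h'⟩
    have hX : ∀ s : ℕ, IsWeightedHomogeneous (fun _ => (1 : ℤ))
        ((∏ l ∈ I, (X l : MvPolynomial (Fin (n + 1)) k)) ^ s) (s * I.card) := fun s => by
      have h1 := (IsWeightedHomogeneous.prod (w := fun _ => (1 : ℤ)) I
        (fun l => (X l : MvPolynomial (Fin (n + 1)) k)) (fun _ => (1 : ℤ))
        (fun l _ => isWeightedHomogeneous_X k _ l)).pow s
      simpa using h1
    refine ⟨t + t', g * (∏ l ∈ I, X l) ^ t' + g' * (∏ l ∈ I, X l) ^ t, ?_, ?_⟩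
    · refine IsWeightedHomogeneous.add ?_ ?_
      · have := hg.mul (hX t')
        convert this using 1
        push_cast
        ring
      · have := hg'.mul (hX t)
        convert this using 1
        push_cast
        ring
    · have hv : Ideal.Quotient.mk (Ideal.span {f}) (∏ l ∈ I, X l) = ∏ l ∈ I, var f l :=
        map_prod _ _ _
      simp only [map_add, map_mul, map_pow, hv, ← h, ← h']
      ring
  smul_mem' := by
    rintro a z ⟨t, g, hg, h⟩
    refine ⟨t, a • g, ?_, ?_⟩
    · exact (weightedHomogeneousSubmodule k (fun _ => (1 : ℤ)) _).smul_mem a hg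
    · have h2 : Ideal.Quotient.mk (Ideal.span {f}) (a • g) =
          a • Ideal.Quotient.mk (Ideal.span {f}) g := rfl
      rw [smul_mul_assoc, h, h2]
      exact ((Algebra.linearMap (Quot f) (Cech.Loc (var f) I)).map_smul_of_tower a _).symm

/-- The Čech cochains of `R/fR` on `x_0, …, x_n` that are homogeneous of internal degree `j`. -/
noncomputable def cochainDeg (j : ℤ) : Submodule k (Cech.Cochain (var f)) :=
  Submodule.pi Set.univ fun I => locDeg f I j

/-- The local cohomology module `H^i_𝔪(R/fR)`. -/
abbrev H (i : ℕ) : Type u := Cech.H (var f) i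

/-- The part `H^i_𝔪(R/fR)_j` of degree `j`: the classes of the homogeneous cocycles of degree
`j`. -/
noncomputable def HDeg (i : ℕ) (j : ℤ) : Submodule k (H f i) :=
  ((cochainDeg f j).comap ((Cech.cocycles (var f) i).subtype.restrictScalars k)).map
    ((Submodule.mkQ ((Cech.coboundaries (var f) i).comap
      (Cech.cocycles (var f) i).subtype)).restrictScalars k)

/-- The part `H^i_𝔪(R/fR)_{≤ N}` of all degrees `j ≤ N`. -/
noncomputable def HLE (i : ℕ) (N : ℤ) : Submodule k (H f i) := ⨆ j : Set.Iic N, HDeg f i j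

variable (p : ℕ) [Fact p.Prime] [CharP k p]

theorem frobenius_mem_locDeg {I : Finset (Fin (n + 1))} {j : ℤ} {z : Cech.Loc (var f) I}
    (hz : z ∈ locDeg f I j) : frobeniusOver k p _ z ∈ locDeg f I (p * j) := by
  obtain ⟨t, g, hg, h⟩ := hz
  refine ⟨p * t, g ^ p, ?_, ?_⟩
  · have := hg.pow p
    convert this using 1
    simp only [nsmul_eq_mul]
    push_cast
    ring
  · change z ^ p * _ = _
    rw [map_pow, map_pow, ← h, mul_pow, ← pow_mul, mul_comm t p]

theorem frobH_mem_HDeg {i : ℕ} {j : ℤ} {z : H f i} (hz : z ∈ HDeg f i j) :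
    Cech.frobH k p (var f) i z ∈ HDeg f i (p * j) := by
  obtain ⟨c, hc, rfl⟩ := hz
  exact ⟨Cech.frobCocycles k p (var f) i c,
    fun I _ => frobenius_mem_locDeg f p (hc I (Set.mem_univ I)), rfl⟩

theorem frobH_mem_HLE {i : ℕ} {N : ℤ} {z : H f i} (hz : z ∈ HLE f i N) :
    Cech.frobH k p (var f) i z ∈ HLE f i (p * N) := by
  refine Submodule.iSup_induction _
    (motive := fun z => Cech.frobH k p (var f) i z ∈ HLE f i (p * N)) hz ?_ ?_ ?_
  · rintro ⟨j, hj⟩ y hy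
    have hj' : (p : ℤ) * j ≤ p * N := mul_le_mul_of_nonneg_left hj (Int.natCast_nonneg p)
    exact Submodule.mem_iSup_of_mem (p := fun j : Set.Iic ((p : ℤ) * N) => HDeg f i j)
      ⟨_, hj'⟩ (frobH_mem_HDeg f p hy)
  · rw [map_zero]
    exact Submodule.zero_mem _
  · intro _ _ hy hy'
    rw [map_add]
    exact Submodule.add_mem _ hy hy'

/-- The Frobenius action `F : H^i_𝔪(R/fR)_{≤ N} → H^i_𝔪(R/fR)_{≤ pN}`. -/
noncomputable def frobeniusLE (i : ℕ) (N : ℤ) : HLE f i N →+ HLE f i (p * N) where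
  toFun z := ⟨Cech.frobH k p (var f) i z, frobH_mem_HLE f p z.2⟩
  map_zero' := Subtype.ext (map_zero _)
  map_add' _ _ := Subtype.ext (map_add _ _ _)

end Defs

end Hypersurface

/-! Choose finitely many p⁻¹-linear maps `φ i` that are coordinates for R over its subring of p-th
powers, and let J be the ideal generated by the `φ i (f ^ (p - 1))`. A polynomial lies in a
Frobenius power I^[p] exactly when all its coordinates lie in I, so J is the smallest ideal with
f^(p-1) ∈ J^[p]. Fedder's criterion (`isFPure_locAt_iff`) then says that J cuts out the non-F-pure
locus. As J is homogeneous, the non-F-pure point is isolated iff J contains a power of 𝔪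
(`forall_prime_lt_maxIdeal_iff`).

The generators of J are forms of degree at most d(p-1)/p, hence at most d-1. If J contains a power
of 𝔪, then over the algebraic closure it contains n+1 forms of degree d-1 that also generate an
𝔪-primary ideal, and such an ideal contains everything of degree > (n+1)(d-2)
(`monomial_mem_span_of_pow_le`). So isolatedness means that R/J vanishes in degrees > (n+1)(d-2).

On the cohomological side, the connecting homomorphism identifies H^n(R/fR) with the kernel of f on
H^{n+1}(R), lowering degrees by d and turning F into f^(p-1)F. A class h/x^t is killed by Frobenius
iff Jh ⊆ (x_0^t, …, x_n^t) (`frobH_mk_eq_zero_iff`). Since f ∈ J, the kernel of Frobenius is the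
whole annihilator of J in H^{n+1}(R), and by Macaulay duality its part of degree -i-(n+1) is dual to
(R/J)_i. Degrees ≤ -n(d-1) in H^n(R/fR) correspond to i > (n+1)(d-2), so injectivity there is the
same vanishing (`injective_frobeniusLE`, `monomial_mem_of_injective_frobeniusLE`). -/

/-! ### Cartier operators as coordinates over the p-th powers. -/

/-- An additive map `φ` of a commutative ring is `p⁻¹`-linear if `φ (r ^ p * g) = r * φ g`. -/
def IsCartierLinear (p : ℕ) {A : Type*} [CommRing A] (φ : A →+ A) : Prop :=
  ∀ r g, φ (r ^ p * g) = r * φ g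

/-- Coordinates with respect to a basis of a finite algebra over a field. -/
theorem RingHom.Finite.exists_coordinates {K B : Type*} [Field K] [CommRing B] {F : K →+* B}
    (hF : F.Finite) : ∃ (N : ℕ) (u : Fin N → B) (π : Fin N → B →+ K),
      (∀ i r g, π i (F r * g) = r * π i g) ∧ ∀ c, c = ∑ i, F (π i c) * u i := by
  algebraize [F]
  let b := Module.finBasis K B
  refine ⟨_, b, fun i => (b.coord i).toAddMonoidHom, fun i r g => ?_, fun c => ?_⟩
  · have := (b.coord i).map_smul r g
    rwa [Algebra.smul_def] at this
  · conv_lhs => rw [← b.sum_repr c]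
    exact Finset.sum_congr rfl fun i _ => Algebra.smul_def _ _

namespace MvPolynomial

variable {σ : Type*} {k : Type*} [Field k]

theorem smul_add_injective {p : ℕ} (hp : 0 < p) (α : σ →₀ ℕ) :
    Function.Injective fun γ : σ →₀ ℕ => p • γ + α := by
  intro γ γ' h
  ext i
  have := DFunLike.congr_fun h i
  simp only [Finsupp.coe_add, Finsupp.coe_smul, Pi.add_apply, Pi.smul_apply, smul_eq_mul,
    add_left_inj] at this
  exact Nat.eq_of_mul_eq_mul_left hp this

/-- The Cartier operator attached to `π : k → k` and an exponent `α`: the coefficient of `x ^ γ`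
in the image of `g` is the image under `π` of the coefficient of `x ^ (p γ + α)` in `g`. -/
noncomputable def cartier {p : ℕ} (hp : 0 < p) (π : k →+ k) (α : σ →₀ ℕ) :
    MvPolynomial σ k →+ MvPolynomial σ k where
  toFun g := AddMonoidAlgebra.map π
    (AddMonoidAlgebra.comapDomain (fun γ : σ →₀ ℕ => p • γ + α) (smul_add_injective hp α) g)
  map_zero' := by ext; simp [coeff]
  map_add' a b := by
    ext γ
    simp [coeff]

@[simp] theorem coeff_cartier {p : ℕ} (hp : 0 < p) (π : k →+ k) (α : σ →₀ ℕ)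
    (g : MvPolynomial σ k) (γ : σ →₀ ℕ) :
    coeff γ (cartier hp π α g) = π (coeff (p • γ + α) g) := by
  simp [cartier, coeff]

/-- Since the entries of `α` are smaller than `p`, x^(pa) divides x^(pδ+α) only if x^a divides x^δ.
So no terms appear on one side without appearing on the other. -/
theorem isCartierLinear_cartier {p : ℕ} [Fact p.Prime] [CharP k p] {π : k →+ k}
    (hπ : IsCartierLinear p π) {α : σ →₀ ℕ} (hα : ∀ i, α i < p) :
    IsCartierLinear p (cartier (Fact.out : p.Prime).pos π α) := by
  classical
  intro r g
  induction r using MvPolynomial.induction_on' with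
  | add r s hr hs => rw [add_pow_char, add_mul, map_add, hr, hs, add_mul]
  | monomial a c =>
    ext δ
    rw [monomial_pow, coeff_cartier, coeff_monomial_mul', coeff_monomial_mul', coeff_cartier]
    by_cases h : a ≤ δ
    · have h1 : p • a ≤ p • δ + α := (nsmul_le_nsmul_right h p).trans le_self_add
      rw [if_pos h, if_pos h1, hπ]
      congr 3
      ext i
      have := h i
      simp only [Finsupp.coe_tsub, Finsupp.coe_add, Finsupp.coe_smul, Pi.sub_apply, Pi.add_apply,
        Pi.smul_apply, smul_eq_mul]
      rw [Nat.mul_sub, Nat.sub_add_comm (Nat.mul_le_mul_left p this)]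
    · rw [if_neg h, if_neg, map_zero]
      contrapose! h
      intro i
      have h2 := h i
      simp only [Finsupp.coe_add, Finsupp.coe_smul, Pi.add_apply,
        Pi.smul_apply, smul_eq_mul] at h2
      have h3 := hα i
      by_contra! h4
      have : p * (δ i + 1) ≤ p * a i := Nat.mul_le_mul_left p h4
      rw [mul_add, mul_one] at this
      omega

/-- A surviving exponent γ satisfies p|γ| + |α| = D, which fixes |γ|. The resulting bound p m ≤ D is
what later forces the generators of J to have degree below d. -/
theorem isHomogeneous_cartier {p : ℕ} (hp : 0 < p) (π : k →+ k) (α : σ →₀ ℕ)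
    {g : MvPolynomial σ k} {D : ℕ} (hg : g.IsHomogeneous D) :
    ∃ m, p * m ≤ D ∧ (cartier hp π α g).IsHomogeneous m := by
  by_cases h : ∃ γ, coeff γ (cartier hp π α g) ≠ 0
  · obtain ⟨γ, hγ⟩ := h
    have key : ∀ γ, coeff γ (cartier hp π α g) ≠ 0 → p * γ.degree + α.degree = D := by
      intro γ hγ
      rw [coeff_cartier] at hγ
      have h1 : coeff (p • γ + α) g ≠ 0 := fun h0 => hγ (by rw [h0, map_zero])
      have h2 : (p • γ + α).degree = D := by
        rw [Finsupp.degree_eq_weight_one]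
        exact hg h1
      rw [← h2, map_add, map_nsmul, smul_eq_mul]
    refine ⟨γ.degree, by have := key γ hγ; omega, fun δ hδ => ?_⟩
    have h1 := key γ hγ
    have h2 := key δ hδ
    change Finsupp.weight (fun _ => 1) δ = _
    rw [← Finsupp.degree_eq_weight_one]
    exact Nat.eq_of_mul_eq_mul_left hp (by omega)
  · push Not at h
    refine ⟨0, by omega, ?_⟩
    rw [show cartier hp π α g = 0 from by ext γ; rw [h γ, coeff_zero]]
    exact isHomogeneous_zero _ _ _

/-- If `k` is finite over its subfield of `p`-th powers, then `k[x]` has a finite family of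
`p⁻¹`-linear maps that are the coordinate functions for a system of generators over the subring of
`p`-th powers. -/
theorem exists_cartier_coordinates [Finite σ] (p : ℕ) [Fact p.Prime] [CharP k p]
    (hk : (frobenius k p).Finite) :
    ∃ (ι : Type) (_ : Fintype ι) (φ : ι → MvPolynomial σ k →+ MvPolynomial σ k)
      (e : ι → MvPolynomial σ k), (∀ i, IsCartierLinear p (φ i)) ∧
      (∀ g, g = ∑ i, φ i g ^ p * e i) ∧
      ∀ i g D, IsHomogeneous g D → ∃ m, p * m ≤ D ∧ (φ i g).IsHomogeneous m := by
  classical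
  have hp : p.Prime := Fact.out
  obtain ⟨N, u, π, hπ, hu⟩ : ∃ (N : ℕ) (u : Fin N → k) (π : Fin N → k →+ k),
      (∀ i, IsCartierLinear p (π i)) ∧ ∀ c, c = ∑ i, π i c ^ p * u i := by
    obtain ⟨N, u, π, hπ, hu⟩ := hk.exists_coordinates
    exact ⟨N, u, π, hπ, hu⟩
  have := Fintype.ofFinite σ
  -- Remainders are indexed by `Fin M` instead of `σ` so that the index type lives in `Type`.
  obtain ⟨M, ⟨eσ⟩⟩ : ∃ M, Nonempty (σ ≃ Fin M) := ⟨_, ⟨Fintype.equivFin σ⟩⟩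
  let al : (Fin M → Fin p) → σ →₀ ℕ := fun a => Finsupp.equivFunOnFinite.symm fun i => a (eσ i)
  refine ⟨(Fin M → Fin p) × Fin N, inferInstance,
    fun i => cartier hp.pos (π i.2) (al i.1), fun i => monomial (al i.1) (u i.2),
    fun i => isCartierLinear_cartier (hπ i.2) (fun j => (i.1 (eσ j)).2), fun g => ?_,
    fun i g D hg => isHomogeneous_cartier _ _ _ hg⟩
  induction g using MvPolynomial.induction_on' with
  | add r s hr hs =>
    nth_rw 1 [hr, hs]
    rw [← Finset.sum_add_distrib]
    exact Finset.sum_congr rfl fun i _ => by rw [map_add, add_pow_char, add_mul]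
  | monomial b c =>
    let a0 : Fin M → Fin p := fun i => ⟨b (eσ.symm i) % p, Nat.mod_lt _ hp.pos⟩
    let γ : σ →₀ ℕ := Finsupp.equivFunOnFinite.symm fun i => b i / p
    -- Division with remainder in every exponent is unique, so a monomial has nonzero coordinates
    -- only for the remainder `a0`.
    have hb : ∀ (a : Fin M → Fin p) (δ : σ →₀ ℕ), b = p • δ + al a → a = a0 ∧ δ = γ := by
      intro a δ h
      have h' : ∀ i, b i = p * δ i + a (eσ i) := fun i => by
        have := DFunLike.congr_fun h i
        simpa [al] using this
      constructor
      · ext i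
        have := h' (eσ.symm i)
        simp [a0, this, Nat.mod_eq_of_lt]
      · ext i
        simp [γ, h', Nat.mul_add_div hp.pos, Nat.div_eq_of_lt]
    have hb0 : p • γ + al a0 = b := by
      ext i
      simp [γ, al, a0, Nat.div_add_mod]
    have hc : ∀ a i, cartier hp.pos (π i) (al a) (monomial b c) =
        if a = a0 then monomial γ (π i c) else 0 := by
      intro a i
      ext δ
      rw [coeff_cartier, coeff_monomial]
      split_ifs with h1 h2 h2
      · rw [coeff_monomial, if_pos (hb a δ h1).2.symm]
      · exact absurd (hb a δ h1).1 h2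
      · subst h2
        rw [coeff_monomial, if_neg, map_zero]
        rintro rfl
        exact h1 hb0.symm
      · simp
    rw [Fintype.sum_prod_type, Finset.sum_eq_single a0]
    · simp only [hc, if_true, monomial_pow, monomial_mul, hb0]
      rw [← map_sum, ← hu c]
    · intro a _ ha
      simp [hc, ha, hp.ne_zero]
    · simp

end MvPolynomial

/-! ### Purity, Frobenius powers of ideals, and localization of p⁻¹-linear maps. -/

/-- A ring homomorphism `F : A → B` with an `A`-linear left inverse is pure. -/
theorem RingHomIsPure.of_retraction {A B : Type u} [CommRing A] [CommRing B] {F : A →+* B}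
    (ψ : B →+ A) (hψ : ∀ a b, ψ (F a * b) = a * ψ b) (h1 : ψ 1 = 1) : RingHomIsPure F := by
  let : Algebra A B := F.toAlgebra
  intro M _ _ m m' (hm : (1 : B) ⊗ₜ[A] m = (1 : B) ⊗ₜ[A] m')
  let T : B →ₗ[A] M →ₗ[A] M := LinearMap.mk₂ A (fun b m => ψ b • m)
    (fun b b' m => by rw [map_add, add_smul])
    (fun a b m => by
      rw [← mul_smul]
      exact congrArg (· • m) (hψ a b))
    (fun b m m' => smul_add _ _ _)
    (fun a b m => smul_comm _ _ _)
  have := congrArg (TensorProduct.lift T) hm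
  simpa [T, h1] using this

/-- Ideals are contracted from their extensions along a pure ring homomorphism. -/
theorem RingHomIsPure.mem_of_map_mem {A B : Type u} [CommRing A] [CommRing B] {F : A →+* B}
    (h : RingHomIsPure F) {I : Ideal A} {v : A} (hv : F v ∈ I.map F) : v ∈ I := by
  let : Algebra A B := F.toAlgebra
  rw [← Ideal.Quotient.eq_zero_iff_mem]
  refine h (A ⧸ I) ?_
  change (1 : B) ⊗ₜ[A] Ideal.Quotient.mk I v = (1 : B) ⊗ₜ[A] 0
  -- Every tensor is moved onto the generator 1 of A/I: this is the identification of B ⊗ A/I with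
  -- B/IB, in which the image of `v` vanishes.
  have h1 : ∀ (b : B) (a : A), b ⊗ₜ[A] Ideal.Quotient.mk I a =
      (F a * b) ⊗ₜ[A] (1 : A ⧸ I) := by
    intro b a
    have h2 : (F a * b) = a • b := rfl
    rw [h2, TensorProduct.smul_tmul]
    congr 1
    rw [Algebra.smul_def, mul_one]
    rfl
  rw [h1, mul_one, TensorProduct.tmul_zero]
  refine Submodule.span_induction (p := fun g _ => g ⊗ₜ[A] (1 : A ⧸ I) = 0) ?_ ?_ ?_ ?_ hv
  · rintro _ ⟨y, hy, rfl⟩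
    rw [← mul_one (F y), ← h1, Ideal.Quotient.eq_zero_iff_mem.mpr hy, TensorProduct.tmul_zero]
  · exact TensorProduct.zero_tmul _ _
  · intro x y _ _ hx hy
    rw [TensorProduct.add_tmul, hx, hy, add_zero]
  · intro r x _ hx
    have := congrArg (TensorProduct.map (LinearMap.mulLeft A r)
      (LinearMap.id : (A ⧸ I) →ₗ[A] _)) hx
    rwa [map_zero] at this

/-- This replaces flatness of Frobenius: p⁻¹-linearity keeps the coordinates of I^[p] inside I, and
the expansion in the `e i` gives the converse. The `e i` need not be a basis. -/
theorem mem_map_frobeniusOver_iff {k : Type*} [Field k] {p : ℕ} [Fact p.Prime] [CharP k p]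
    {R : Type*} [CommRing R] [Algebra k R] {ι : Type*} [Fintype ι] {φ : ι → R →+ R} {e : ι → R}
    (hφ : ∀ i, IsCartierLinear p (φ i)) (he : ∀ g, g = ∑ i, φ i g ^ p * e i)
    {I : Ideal R} {g : R} : g ∈ I.map (frobeniusOver k p R) ↔ ∀ i, φ i g ∈ I := by
  constructor
  · intro hg
    -- The `φ i` are only additive over R, so the induction has to carry all multiples of `g`.
    suffices h : ∀ a i, φ i (a * g) ∈ I by simpa using h 1
    refine Submodule.span_induction
      (p := fun g _ => ∀ a i, φ i (a * g) ∈ I) ?_ ?_ ?_ ?_ hg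
    · rintro _ ⟨y, hy, rfl⟩ a i
      change φ i (a * y ^ p) ∈ I
      rw [mul_comm, hφ]
      exact I.mul_mem_right _ hy
    · simp
    · intro x y _ _ hx hy a i
      rw [mul_add, map_add]
      exact I.add_mem (hx a i) (hy a i)
    · intro r x _ hx a i
      rw [smul_eq_mul, ← mul_assoc]
      exact hx _ _
  · intro hg
    rw [he g]
    exact Ideal.sum_mem _ fun i _ =>
      Ideal.mul_mem_right _ _ (Ideal.mem_map_of_mem (frobeniusOver k p R) (hg i))

/-- A `p⁻¹`-linear map extends along a localization map `ρ` if it preserves the kernel of `ρ`. -/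
theorem IsCartierLinear.exists_localization {p : ℕ} (hp : 0 < p) {R B : Type*} [CommRing R]
    [CommRing B] {Φ : R →+ R} (hΦ : IsCartierLinear p Φ) (ρ : R →+* B) (S : Submonoid R)
    (hS : ∀ s ∈ S, IsUnit (ρ s)) (hsurj : ∀ z, ∃ s ∈ S, ∃ a, z * ρ s = ρ a)
    (hker : ∀ a, ρ a = 0 → ρ (Φ a) = 0) :
    ∃ ψ : B →+ B, IsCartierLinear p ψ ∧ ∀ a, ψ (ρ a) = ρ (Φ a) := by
  have hpp : ∀ x : R, x ^ p = x * x ^ (p - 1) := fun x => (mul_pow_sub_one hp.ne' x).symm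
  -- From a/s = a s^(p-1) / s^p, the value at a/s is forced to be Φ(a s^(p-1)) / s.
  have key : ∀ z, ∃ w, ∀ s ∈ S, ∀ a, z * ρ s = ρ a → w * ρ s = ρ (Φ (a * s ^ (p - 1))) := by
    intro z
    obtain ⟨s, hs, a, hz⟩ := hsurj z
    obtain ⟨u, hu⟩ := hS s hs
    refine ⟨ρ (Φ (a * s ^ (p - 1))) * ↑u⁻¹, fun s' hs' a' hz' => ?_⟩
    rw [mul_assoc, mul_comm (↑u⁻¹ : B), ← mul_assoc, Units.mul_inv_eq_iff_eq_mul, hu, ← map_mul,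
      ← map_mul, ← sub_eq_zero, ← map_sub, mul_comm _ s', mul_comm _ s, ← hΦ, ← hΦ, ← map_sub]
    -- Two representations of the same fraction differ by a multiple of a s' - a' s, which `ρ`
    -- kills.
    apply hker
    have h0 : ρ (a * s' - a' * s) = 0 := by
      rw [map_sub, map_mul, map_mul, ← hz, ← hz']
      ring
    have : s' ^ p * (a * s ^ (p - 1)) - s ^ p * (a' * s' ^ (p - 1)) =
        (a * s' - a' * s) * (s ^ (p - 1) * s' ^ (p - 1)) := by
      rw [hpp, hpp]
      ring
    rw [this, map_mul, h0, zero_mul]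
  choose ψ hψ using key
  have hψ' : ∀ z w s, s ∈ S → ∀ a, z * ρ s = ρ a → w * ρ s = ρ (Φ (a * s ^ (p - 1))) →
      ψ z = w := by
    intro z w s hs a hz hw
    exact (hS s hs).mul_right_cancel ((hψ z s hs a hz).trans hw.symm)
  refine ⟨AddMonoidHom.mk' ψ fun z z' => ?_, fun r z => ?_, fun a => ?_⟩
  · obtain ⟨s, hs, a, hz⟩ := hsurj z
    obtain ⟨s', hs', a', hz'⟩ := hsurj z'
    refine hψ' _ _ (s * s') (S.mul_mem hs hs') (a * s' + a' * s) ?_ ?_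
    · simp only [map_mul, map_add, ← hz, ← hz']
      ring
    · have h1 := hψ z s hs a hz
      have h2 := hψ z' s' hs' a' hz'
      have e1 : (a * s' + a' * s) * (s * s') ^ (p - 1) =
          s' ^ p * (a * s ^ (p - 1)) + s ^ p * (a' * s' ^ (p - 1)) := by
        rw [hpp, hpp]
        ring
      rw [e1, map_add Φ, hΦ, hΦ, map_add ρ, map_mul ρ, map_mul ρ, map_mul ρ, ← h1, ← h2]
      ring
  · obtain ⟨s, hs, a, hz⟩ := hsurj z
    obtain ⟨t, ht, b, hr⟩ := hsurj r
    refine hψ' _ _ (s * t ^ p) (S.mul_mem hs (pow_mem ht p)) (b ^ p * a) ?_ ?_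
    · rw [map_mul, map_mul, map_pow, map_pow, ← hz, ← hr]
      ring
    · have h1 := hψ z s hs a hz
      have e1 : b ^ p * a * (s * t ^ p) ^ (p - 1) = (b * t ^ (p - 1)) ^ p * (a * s ^ (p - 1)) := by
        ring
      change r * ψ z * _ = _
      rw [e1, hΦ, hpp t]
      simp only [map_mul, ← h1, ← hr]
      ring
  · refine hψ' _ _ 1 S.one_mem a (by simp) (by simp)

/-- If a `p⁻¹`-linear map takes a unit value at `1`, then the Frobenius map is pure. -/
theorem IsFPure.of_isCartierLinear {k : Type u} [Field k] {p : ℕ} [Fact p.Prime] [CharP k p]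
    {B : Type u} [CommRing B] [Algebra k B] {ψ : B →+ B} (hψ : IsCartierLinear p ψ)
    (h1 : IsUnit (ψ 1)) : IsFPure k p B := by
  obtain ⟨w, hw⟩ := h1
  -- Premultiplying by w⁻¹ to the power p divides the value at 1 by w = ψ(1), normalizing it to 1.
  refine RingHomIsPure.of_retraction (ψ.comp (AddMonoidHom.mulLeft ((↑w⁻¹ : B) ^ p))) ?_ ?_
  · intro a b
    change ψ (_ * (a ^ p * b)) = a * ψ (_ * b)
    rw [mul_left_comm, hψ]
  · change ψ (_ * 1) = 1
    rw [hψ, ← hw, Units.inv_mul]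

namespace Hypersurface

open MvPolynomial

variable {k : Type u} [Field k] {n : ℕ} (f : MvPolynomial (Fin (n + 1)) k)
  (P : Ideal (MvPolynomial (Fin (n + 1)) k)) [P.IsPrime]

/-- The canonical map from the polynomial ring to `(R/fR)_P`. -/
noncomputable def toLocAt : MvPolynomial (Fin (n + 1)) k →+* LocAt f P :=
  (algebraMap (Quot f) (LocAt f P)).comp (Ideal.Quotient.mk (Ideal.span {f}))

theorem isUnit_toLocAt {s : MvPolynomial (Fin (n + 1)) k} (hs : s ∉ P) :
    IsUnit (toLocAt f P s) :=
  IsLocalization.map_units (LocAt f P)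
    (⟨_, ⟨s, hs, rfl⟩⟩ : Algebra.algebraMapSubmonoid (Quot f) P.primeCompl)

theorem exists_mul_toLocAt_eq (z : LocAt f P) :
    ∃ s ∈ P.primeCompl, ∃ a, z * toLocAt f P s = toLocAt f P a := by
  obtain ⟨⟨a, ⟨_, ⟨s, hs, rfl⟩⟩⟩, h⟩ :=
    IsLocalization.surj (Algebra.algebraMapSubmonoid (Quot f) P.primeCompl) z
  obtain ⟨a, rfl⟩ := Ideal.Quotient.mk_surjective a
  exact ⟨s, hs, a, h⟩

theorem toLocAt_eq_zero_iff {a : MvPolynomial (Fin (n + 1)) k} :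
    toLocAt f P a = 0 ↔ ∃ s ∉ P, f ∣ s * a := by
  constructor
  · intro h
    obtain ⟨⟨_, ⟨s, hs, rfl⟩⟩, h⟩ := (IsLocalization.map_eq_zero_iff
      (Algebra.algebraMapSubmonoid (Quot f) P.primeCompl) (LocAt f P) _).mp h
    refine ⟨s, hs, ?_⟩
    change Ideal.Quotient.mk (Ideal.span {f}) s * Ideal.Quotient.mk (Ideal.span {f}) a = 0 at h
    rwa [← map_mul, Ideal.Quotient.eq_zero_iff_mem, Ideal.mem_span_singleton] at h
  · rintro ⟨s, hs, h⟩
    refine (isUnit_toLocAt f P hs).mul_left_cancel ?_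
    rw [← map_mul, mul_zero]
    rw [← Ideal.mem_span_singleton, ← Ideal.Quotient.eq_zero_iff_mem] at h
    change algebraMap _ (LocAt f P) (Ideal.Quotient.mk (Ideal.span {f}) (s * a)) = 0
    rw [h, map_zero]

variable {f P}

/-- A `p⁻¹`-linear map that preserves `(f)` and does not map `1` into `P` gives a Frobenius
splitting of `(R/fR)_P`. -/
theorem isFPure_locAt_of_isCartierLinear {p : ℕ} [Fact p.Prime] [CharP k p]
    {Φ : MvPolynomial (Fin (n + 1)) k →+ MvPolynomial (Fin (n + 1)) k}
    (hΦ : IsCartierLinear p Φ) (hf : ∀ a, f ∣ a → f ∣ Φ a) (h1 : Φ 1 ∉ P) :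
    IsFPure k p (LocAt f P) := by
  have hker : ∀ a, toLocAt f P a = 0 → toLocAt f P (Φ a) = 0 := by
    intro a ha
    obtain ⟨s, hs, h⟩ := (toLocAt_eq_zero_iff f P).mp ha
    refine (toLocAt_eq_zero_iff f P).mpr ⟨s, hs, ?_⟩
    -- s Φ(a) = Φ(s^p a), and f divides s^p a because it divides s a.
    rw [← hΦ]
    refine hf _ (h.trans (mul_dvd_mul_right ?_ _))
    exact dvd_pow_self _ (Fact.out : p.Prime).ne_zero
  obtain ⟨ψ, hψ, hψ'⟩ := 
    IsCartierLinear.exists_localization (B := LocAt f P) (Fact.out : p.Prime).pos hΦ (toLocAt f P)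
      P.primeCompl (fun s hs => isUnit_toLocAt f P hs) (exists_mul_toLocAt_eq f P) hker
  refine IsFPure.of_isCartierLinear hψ ?_
  rw [← map_one (toLocAt f P), hψ']
  exact isUnit_toLocAt f P h1

end Hypersurface

/-! ### Fedder's criterion for hypersurfaces. -/

/-- Either some element outside of `K` is multiplied into `K` by the ideal `P`, or `P` contains a
regular element modulo `K`. -/
theorem Ideal.exists_socle_or_exists_regular {R : Type*} [CommRing R] [IsNoetherianRing R]
    (P K : Ideal R) :
    (∃ v ∉ K, ∀ y ∈ P, y * v ∈ K) ∨ ∃ y ∈ P, ∀ a, y * a ∈ K → a ∈ K := by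
  -- Prime avoidance for the associated primes of R/K: either P lies in one of them, the annihilator
  -- of some `v`, or some y ∈ P avoids all of them and hence all zero divisors.
  by_cases h : (P : Set R) ⊆ ⋃ Q ∈ ((associatedPrimes.finite R (R ⧸ K)).toFinset : Set (Ideal R)), Q
  · left
    obtain ⟨Q, hQ, hPQ⟩ := (Ideal.subset_union_prime (f := id) ⊤ ⊤ (fun Q hQ _ _ =>
      ((associatedPrimes.finite R (R ⧸ K)).mem_toFinset.mp hQ).isPrime)).mp h
    obtain ⟨hQ', x, hx⟩ := isAssociatedPrime_iff.mp
      ((associatedPrimes.finite R (R ⧸ K)).mem_toFinset.mp hQ)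
    obtain ⟨v, rfl⟩ := Ideal.Quotient.mk_surjective x
    have hmem : ∀ r, r ∈ Q ↔ r * v ∈ K := by
      intro r
      rw [hx, Submodule.mem_colon_singleton, Submodule.mem_bot, ← Ideal.Quotient.eq_zero_iff_mem,
        map_mul, Algebra.smul_def]
      rfl
    refine ⟨v, fun hv => hQ'.ne_top ((Ideal.eq_top_iff_one _).mpr ?_), fun y hy =>
      (hmem y).mp (hPQ hy)⟩
    rw [hmem, one_mul]
    exact hv
  · right
    obtain ⟨y, hy, hy'⟩ := Set.not_subset.mp h
    refine ⟨y, hy, fun a ha => ?_⟩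
    by_contra ha'
    rw [Set.Finite.coe_toFinset, biUnion_associatedPrimes_eq_zero_divisors] at hy'
    refine hy' ⟨Ideal.Quotient.mk K a, ?_, ?_⟩
    · rwa [Ne, Ideal.Quotient.eq_zero_iff_mem]
    · rw [Algebra.smul_def]
      exact Ideal.Quotient.eq_zero_iff_mem.mpr ha

namespace Hypersurface

open MvPolynomial

variable {k : Type u} [Field k] {n : ℕ} {f : MvPolynomial (Fin (n + 1)) k}
  {P : Ideal (MvPolynomial (Fin (n + 1)) k)} [P.IsPrime]

/-- The elements that are multiplied into `K` by some element outside of the prime `P`. -/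
def primeSaturation {R : Type*} [CommRing R] (P : Ideal R) [P.IsPrime] (K : Ideal R) :
    Ideal R where
  carrier := {a | ∃ s ∉ P, s * a ∈ K}
  zero_mem' := ⟨1, (Ideal.ne_top_iff_one P).mp (Ideal.IsPrime.ne_top ‹_›), by simp⟩
  add_mem' := by
    rintro a b ⟨s, hs, h⟩ ⟨t, ht, h'⟩
    refine ⟨s * t, P.primeCompl.mul_mem hs ht, ?_⟩
    have : s * t * (a + b) = t * (s * a) + s * (t * b) := by ring
    rw [this]
    exact K.add_mem (K.mul_mem_left _ h) (K.mul_mem_left _ h')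
  smul_mem' := by
    rintro c a ⟨s, hs, h⟩
    refine ⟨s, hs, ?_⟩
    rw [smul_eq_mul, mul_left_comm]
    exact K.mul_mem_left _ h

/-- A substitute for a system of parameters. Take I maximal among the P-saturated ideals inside P
modulo which f is regular. If some y ∈ P were regular modulo the saturation of I + (f), the regular
sequence f, y could be permuted, so f would stay regular modulo the saturation of the larger ideal I
+ (y). Hence R_P/(I, f) has depth zero, and v represents a socle element. -/
theorem exists_maximal_regular_ideal {R : Type*} [CommRing R] [IsNoetherianRing R] [IsDomain R]
    (P : Ideal R) [P.IsPrime] {f : R} (hf0 : f ≠ 0) (hfP : f ∈ P) :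
    ∃ I : Ideal R, I ≤ P ∧ (∀ a, f * a ∈ I → a ∈ I) ∧
      ∃ v, v ∉ primeSaturation P (I ⊔ Ideal.span {f}) ∧
        ∀ y ∈ P, y * v ∈ primeSaturation P (I ⊔ Ideal.span {f}) := by
  obtain ⟨I, ⟨hIP, hIs, hIf⟩, hmax⟩ := (wellFounded_gt (α := Ideal R)).has_min
    {I | I ≤ P ∧ (∀ s ∉ P, ∀ a, s * a ∈ I → a ∈ I) ∧ ∀ a, f * a ∈ I → a ∈ I}
    ⟨⊥, bot_le, fun s hs a ha => by
      rcases mul_eq_zero.mp ((Submodule.mem_bot R).mp ha) with rfl | h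
      · exact absurd P.zero_mem hs
      · exact h, fun a ha => (mul_eq_zero.mp ((Submodule.mem_bot R).mp ha)).resolve_left hf0⟩
  refine ⟨I, hIP, hIf, ?_⟩
  set K := primeSaturation P (I ⊔ Ideal.span {f}) with hK
  have hsat : ∀ {L : Ideal R}, L ≤ primeSaturation P L := fun {L} a ha =>
    ⟨1, (Ideal.ne_top_iff_one P).mp (Ideal.IsPrime.ne_top ‹_›), by rwa [one_mul]⟩
  have hle : ∀ {L : Ideal R}, L ≤ P → primeSaturation P L ≤ P := by
    rintro L hL a ⟨s, hs, h⟩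
    exact (Ideal.IsPrime.mem_or_mem ‹_› (hL h)).resolve_left hs
  have hKP : K ≤ P := hle (sup_le hIP ((Ideal.span_singleton_le_iff_mem _).mpr hfP))
  rcases Ideal.exists_socle_or_exists_regular P K with ⟨v, hv, h⟩ | ⟨y, hyP, hy⟩
  · exact ⟨v, hv, h⟩
  · exfalso
    refine hmax (primeSaturation P (I ⊔ Ideal.span {y})) ⟨?_, ?_, ?_⟩ ?_
    · exact hle (sup_le hIP ((Ideal.span_singleton_le_iff_mem _).mpr hyP))
    · rintro s hs a ⟨t, ht, h⟩
      exact ⟨t * s, P.primeCompl.mul_mem ht hs, by rwa [mul_assoc]⟩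
    · rintro a ⟨s, hs, h⟩
      obtain ⟨i, hi, _, hb, hib⟩ := Submodule.mem_sup.mp h
      obtain ⟨b, rfl⟩ := Ideal.mem_span_singleton'.mp hb
      have hbK : b ∈ K := by
        refine hy b (hsat ?_)
        have : y * b = -i + f * (s * a) := by linear_combination hib
        rw [this]
        exact Ideal.add_mem _ (Ideal.mem_sup_left (I.neg_mem hi))
          (Ideal.mem_sup_right (Ideal.mul_mem_right _ _ (Ideal.mem_span_singleton_self f)))
      obtain ⟨s', hs', h'⟩ := hbK
      obtain ⟨i', hi', _, hb', hib'⟩ := Submodule.mem_sup.mp h'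
      obtain ⟨b', rfl⟩ := Ideal.mem_span_singleton'.mp hb'
      refine ⟨s' * s, P.primeCompl.mul_mem hs' hs, ?_⟩
      have h1 : s' * s * a - y * b' ∈ I := by
        refine hIf _ ?_
        have : f * (s' * s * a - y * b') = s' * i + y * i' := by
          linear_combination (-s') * hib - y * hib'
        rw [this]
        exact I.add_mem (I.mul_mem_left _ hi) (I.mul_mem_left _ hi')
      rw [← sub_add_cancel (s' * s * a) (y * b')]
      exact Ideal.add_mem _ (Ideal.mem_sup_left h1)
        (Ideal.mem_sup_right (Ideal.mul_mem_right _ _ (Ideal.mem_span_singleton_self y)))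
    · refine lt_of_le_of_ne (le_sup_left.trans hsat) fun h => ?_
      -- The enlargement is strict: if y lay in I, regularity of y modulo K would put 1 into K ⊆ P.
      have hyI : y ∈ I := by
        rw [h]
        exact hsat (Ideal.mem_sup_right (Ideal.mem_span_singleton_self y))
      have : (1 : R) ∈ K := hy 1 (by
        rw [mul_one]
        exact hsat (Ideal.mem_sup_left hyI))
      exact (Ideal.ne_top_iff_one P).mp (Ideal.IsPrime.ne_top ‹_›) (hKP this)

/-- The non-F-purity half of Fedder's criterion. -/
theorem not_isFPure_locAt {p : ℕ} [Fact p.Prime] [CharP k p] {ι : Type*} [Fintype ι]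
    {φ : ι → MvPolynomial (Fin (n + 1)) k →+ MvPolynomial (Fin (n + 1)) k}
    {e : ι → MvPolynomial (Fin (n + 1)) k}
    (hφ : ∀ i, IsCartierLinear p (φ i)) (he : ∀ g, g = ∑ i, φ i g ^ p * e i)
    (hf0 : f ≠ 0) (hfP : f ∈ P) (hf : ∀ i, φ i (f ^ (p - 1)) ∈ P) :
    ¬ IsFPure k p (LocAt f P) := by
  intro hpure
  obtain ⟨I, hIP, hIf, v, hv, hPv⟩ := exists_maximal_regular_ideal P hf0 hfP
  have hpp : ∀ x : MvPolynomial (Fin (n + 1)) k, x ^ p = x * x ^ (p - 1) :=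
    fun x => (mul_pow_sub_one (Fact.out : p.Prime).ne_zero x).symm
  -- The socle property clears each coordinate only up to an element outside P; finitely many
  -- coordinates allow one common multiplier.
  obtain ⟨s, hs, hsv⟩ : ∃ s ∉ P, ∀ i, s * (φ i (f ^ (p - 1)) * v) ∈ I ⊔ Ideal.span {f} := by
    choose s hs h using fun i => hPv _ (hf i)
    refine ⟨∏ i, s i, P.primeCompl.prod_mem fun i _ => hs i, fun i => ?_⟩
    obtain ⟨c, hc⟩ := Finset.dvd_prod_of_mem s (Finset.mem_univ i)
    rw [hc, mul_comm (s i), mul_assoc]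
    exact Ideal.mul_mem_left _ _ (h i)
  -- `s ^ p * v ^ p * f ^ (p - 1)` lies in the Frobenius power of `I + (f)`
  have h1 : (s * v) ^ p * f ^ (p - 1) ∈
      (I ⊔ Ideal.span {f}).map (frobeniusOver k p (MvPolynomial (Fin (n + 1)) k)) := by
    rw [mem_map_frobeniusOver_iff hφ he]
    intro i
    rw [hφ, mul_assoc, mul_comm v]
    exact hsv i
  rw [Ideal.map_sup, Ideal.map_span, Set.image_singleton] at h1
  obtain ⟨x, hx, _, hc, hxc⟩ := Submodule.mem_sup.mp h1
  obtain ⟨c, rfl⟩ := Ideal.mem_span_singleton'.mp hc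
  have h2 : f ^ (p - 1) * ((s * v) ^ p - f * c) = x := by
    have : frobeniusOver k p (MvPolynomial (Fin (n + 1)) k) f = f * f ^ (p - 1) := hpp f
    rw [this] at hxc
    linear_combination -hxc
  -- f is regular modulo I^[p] too: multiply by f to reach f^p and read the membership in
  -- coordinates, where f is regular modulo I.
  have h3 : (s * v) ^ p - f * c ∈
      I.map (frobeniusOver k p (MvPolynomial (Fin (n + 1)) k)) := by
    rw [mem_map_frobeniusOver_iff hφ he]
    intro i
    refine hIf _ ?_
    rw [← hφ, hpp, mul_assoc, h2]
    have := Ideal.mul_mem_left _ f hx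
    rw [mem_map_frobeniusOver_iff hφ he] at this
    exact this i
  -- Modulo f, the p-th power of s v lies in the Frobenius power of I. Purity then removes the p-th
  -- power and puts v into I + (f) locally, against the choice of v.
  have h4 : toLocAt f P ((s * v) ^ p) ∈ (I.map (toLocAt f P)).map
      (frobeniusOver k p (LocAt f P)) := by
    have hcomp : (frobeniusOver k p (LocAt f P)).comp (toLocAt f P) =
        (toLocAt f P).comp (frobeniusOver k p (MvPolynomial (Fin (n + 1)) k)) :=
      RingHom.ext fun a => (map_pow (toLocAt f P) a p).symm
    rw [Ideal.map_map, hcomp, ← Ideal.map_map]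
    have hf' : toLocAt f P f = 0 := (toLocAt_eq_zero_iff f P).mpr
      ⟨1, (Ideal.ne_top_iff_one P).mp (Ideal.IsPrime.ne_top ‹_›), by rw [one_mul]⟩
    have := Ideal.mem_map_of_mem (toLocAt f P) h3
    rwa [map_sub, map_mul, hf', zero_mul, sub_zero] at this
  rw [map_pow] at h4
  have h5 : toLocAt f P (s * v) ∈ I.map (toLocAt f P) := hpure.mem_of_map_mem h4
  -- descend to the polynomial ring
  obtain ⟨t, ht, a, ha, hta⟩ : ∃ t ∉ P, ∃ a ∈ I, toLocAt f P (s * v) * toLocAt f P t =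
      toLocAt f P a := by
    refine Submodule.span_induction (p := fun z _ => ∃ t ∉ P, ∃ a ∈ I, z * toLocAt f P t =
      toLocAt f P a) ?_ ?_ ?_ ?_ h5
    · rintro _ ⟨a, ha, rfl⟩
      exact ⟨1, (Ideal.ne_top_iff_one P).mp (Ideal.IsPrime.ne_top ‹_›), a, ha, by simp⟩
    · exact ⟨1, (Ideal.ne_top_iff_one P).mp (Ideal.IsPrime.ne_top ‹_›), 0, I.zero_mem, by simp⟩
    · rintro z z' _ _ ⟨t, ht, a, ha, h⟩ ⟨t', ht', a', ha', h'⟩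
      refine ⟨t * t', P.primeCompl.mul_mem ht ht', a * t' + a' * t,
        I.add_mem (I.mul_mem_right _ ha) (I.mul_mem_right _ ha'), ?_⟩
      simp only [map_mul, map_add, ← h, ← h']
      ring
    · rintro r z _ ⟨t, ht, a, ha, h⟩
      obtain ⟨u, hu, b, hb⟩ := exists_mul_toLocAt_eq f P r
      refine ⟨u * t, P.primeCompl.mul_mem hu ht, b * a, I.mul_mem_left _ ha, ?_⟩
      simp only [map_mul, ← h, ← hb, smul_eq_mul]
      ring
  rw [← map_mul, ← sub_eq_zero, ← map_sub, toLocAt_eq_zero_iff] at hta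
  obtain ⟨w, hw, c', hc'⟩ := hta
  refine hv ⟨w * t * s, P.primeCompl.mul_mem (P.primeCompl.mul_mem hw ht) hs, ?_⟩
  have : w * t * s * v = w * a + f * c' := by linear_combination hc'
  rw [this]
  exact Ideal.add_mem _ (Ideal.mem_sup_left (I.mul_mem_left _ ha))
    (Ideal.mem_sup_right (Ideal.mul_mem_right _ _ (Ideal.mem_span_singleton_self f)))

end Hypersurface

namespace Hypersurface

open MvPolynomial

variable {k : Type u} [Field k] {n : ℕ} {f : MvPolynomial (Fin (n + 1)) k}

section Fedder

variable {p : ℕ} [Fact p.Prime] [CharP k p] {ι : Type*} [Fintype ι]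
    {φ : ι → MvPolynomial (Fin (n + 1)) k →+ MvPolynomial (Fin (n + 1)) k}
    {e : ι → MvPolynomial (Fin (n + 1)) k}

/-- Multiplying f^(p-1) ∈ J^[p] by f gives f φ_i(1) ∈ J for all i, and expanding 1 in coordinates
recovers f. So primes not containing f never contain J, and the annihilator of J in H^{n+1}(R) is
annihilated by f. -/
theorem mem_span_range_cartier (hφ : ∀ i, IsCartierLinear p (φ i))
    (he : ∀ g, g = ∑ i, φ i g ^ p * e i) :
    f ∈ Ideal.span (Set.range fun i => φ i (f ^ (p - 1))) := by
  set J := Ideal.span (Set.range fun i => φ i (f ^ (p - 1))) with hJ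
  have h1 : f ^ (p - 1) ∈ J.map (frobeniusOver k p (MvPolynomial (Fin (n + 1)) k)) :=
    (mem_map_frobeniusOver_iff hφ he).mpr fun i => Ideal.subset_span ⟨i, rfl⟩
  have h2 := (mem_map_frobeniusOver_iff hφ he).mp (Ideal.mul_mem_left _ f h1)
  rw [mul_pow_sub_one (Fact.out : p.Prime).ne_zero] at h2
  have h3 : f = ∑ i, f * φ i 1 ^ p * e i := by
    conv_lhs => rw [← mul_one f, he 1, Finset.mul_sum]
    exact Finset.sum_congr rfl fun i _ => (mul_assoc _ _ _).symm
  rw [h3]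
  refine Ideal.sum_mem _ fun i _ => Ideal.mul_mem_right _ _ ?_
  have h4 := h2 i
  rw [← mul_one (f ^ p), hφ] at h4
  rw [← mul_pow_sub_one (Fact.out : p.Prime).ne_zero, ← mul_assoc]
  exact Ideal.mul_mem_right _ _ h4

/-- Fedder's criterion for hypersurfaces, in terms of the Cartier operators. -/
theorem isFPure_locAt_iff (hφ : ∀ i, IsCartierLinear p (φ i))
    (he : ∀ g, g = ∑ i, φ i g ^ p * e i) (hf0 : f ≠ 0)
    (P : Ideal (MvPolynomial (Fin (n + 1)) k)) [P.IsPrime] :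
    IsFPure k p (LocAt f P) ↔ ¬ Ideal.span (Set.range fun i => φ i (f ^ (p - 1))) ≤ P := by
  constructor
  · intro h hJ
    exact not_isFPure_locAt hφ he hf0 (hJ (mem_span_range_cartier hφ he))
      (fun i => hJ (Ideal.subset_span ⟨i, rfl⟩)) h
  · intro h
    rw [Ideal.span_le, Set.range_subset_iff] at h
    push Not at h
    obtain ⟨i, hi⟩ := h
    -- The operator g ↦ φ_i(f^(p-1) g) preserves (f) because φ_i(f^p b) = f φ_i(b), and its value at
    -- 1 is a generator of J outside P.
    refine isFPure_locAt_of_isCartierLinear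
      (Φ := (φ i).comp (AddMonoidHom.mulLeft (f ^ (p - 1)))) ?_ ?_ ?_
    · intro r g
      change φ i (_ * (r ^ p * g)) = r * φ i (_ * g)
      rw [mul_left_comm, hφ]
    · rintro _ ⟨b, rfl⟩
      change f ∣ φ i (_ * (f * b))
      rw [← mul_assoc, pow_sub_one_mul (Fact.out : p.Prime).ne_zero, hφ]
      exact dvd_mul_right _ _
    · change φ i (_ * 1) ∉ P
      rwa [mul_one]

/-- The localizations of a polynomial ring are F-pure. -/
theorem isFPure_locAt_zero (hφ : ∀ i, IsCartierLinear p (φ i))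
    (he : ∀ g, g = ∑ i, φ i g ^ p * e i)
    (P : Ideal (MvPolynomial (Fin (n + 1)) k)) [P.IsPrime] :
    IsFPure k p (LocAt 0 P) := by
  obtain ⟨i, hi⟩ : ∃ i, φ i 1 ∉ P := by
    by_contra! h
    refine (Ideal.ne_top_iff_one P).mp (Ideal.IsPrime.ne_top ‹_›) ?_
    rw [he 1]
    exact Ideal.sum_mem _ fun i _ => Ideal.mul_mem_right _ _
      (Ideal.pow_mem_of_mem _ (h i) _ (Fact.out : p.Prime).pos)
  refine isFPure_locAt_of_isCartierLinear (hφ i) (fun a ha => ?_) hi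
  rw [zero_dvd_iff] at ha
  rw [ha, map_zero]

end Fedder

/-! ### Isolated points of homogeneous loci. -/

/-- A homogeneous ideal is contained in no prime ideal that is properly contained in the
homogeneous maximal ideal if and only if it contains a power of the homogeneous maximal ideal. -/
theorem forall_prime_lt_maxIdeal_iff {J : Ideal (MvPolynomial (Fin (n + 1)) k)}
    (hJ : ∃ S : Set (MvPolynomial (Fin (n + 1)) k), J = Ideal.span S ∧
      ∀ g ∈ S, ∃ m, g.IsHomogeneous m) :
    (∀ (P : Ideal (MvPolynomial (Fin (n + 1)) k)) [P.IsPrime], P < maxIdeal k n → ¬ J ≤ P) ↔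
      ∃ s, maxIdeal k n ^ s ≤ J := by
  constructor
  · intro h
    refine Ideal.exists_pow_le_of_le_radical_of_fg ?_
      (Submodule.fg_span (Set.finite_range _))
    rw [maxIdeal, Ideal.span_le]
    rintro _ ⟨i, rfl⟩
    change X i ∈ J.radical
    rw [Ideal.radical_eq_sInf, Ideal.mem_sInf]
    rintro P ⟨hJP, hP⟩
    by_contra hi
    let _ : GradedAlgebra (homogeneousSubmodule (Fin (n + 1)) k) := gradedAlgebra
    have hJh : J.IsHomogeneous (homogeneousSubmodule (Fin (n + 1)) k) := by
      obtain ⟨S, rfl, hS⟩ := hJ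
      exact Ideal.homogeneous_span _ _ fun g hg => hS g hg
    -- The homogeneous core of P is prime and still contains J. It lies in 𝔪, since a nonzero
    -- constant term would be a unit in it, and it differs from 𝔪 because X i ∉ P.
    let Q := (P.homogeneousCore (homogeneousSubmodule (Fin (n + 1)) k)).toIdeal
    have hQ : Q.IsPrime := hP.homogeneousCore
    have hQP : Q ≤ P := Ideal.toIdeal_homogeneousCore_le _ _
    have hJQ : J ≤ Q := by
      rw [← hJh.toIdeal_homogeneousCore_eq_self]
      exact Ideal.homogeneousCore_mono _ hJP
    refine h Q (lt_of_le_of_ne ?_ ?_) hJQ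
    · intro g hg
      have h0 := (P.homogeneousCore (homogeneousSubmodule (Fin (n + 1)) k)).isHomogeneous 0 hg
      replace h0 : C (coeff 0 g) ∈ Q := by
        rw [← homogeneousComponent_zero, ← decomposition.decompose'_apply]
        exact h0
      have hg0 : coeff 0 g = 0 := by
        by_contra hne
        refine hQ.ne_top (Ideal.eq_top_of_isUnit_mem _ h0 ?_)
        exact (isUnit_iff_ne_zero.mpr hne).map C
      rw [maxIdeal, ← Set.image_univ, mem_ideal_span_X_image]
      intro m hm
      by_contra! hc
      have : m = 0 := Finsupp.ext fun i => hc i (Set.mem_univ i)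
      rw [this, mem_support_iff] at hm
      exact hm hg0
    · intro hQm
      refine hi (hQP ?_)
      rw [hQm]
      exact Ideal.subset_span ⟨i, rfl⟩
  · rintro ⟨s, hs⟩ P hP hlt hJP
    exact hlt.not_ge (hP.le_of_pow_le (hs.trans hJP))

end Hypersurface

/-! ### The socle degree bound for N forms in N variables, by Frobenius powers. -/

namespace MvPolynomial

section Socle

/-- Iterating a Cartier operator: over a perfect field and for `q = p ^ e` there is a
`q⁻¹`-linear map that takes `x ^ (q a + (q - 1))` to `x ^ a`. -/
theorem exists_iterated_trace {σ K : Type*} [Finite σ] [Field K] (p : ℕ) [Fact p.Prime] [CharP K p]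
    [PerfectRing K p] (e : ℕ) :
    ∃ Ψ : MvPolynomial σ K →+ MvPolynomial σ K, IsCartierLinear (p ^ e) Ψ ∧
      ∀ a : σ →₀ ℕ, Ψ (monomial (p ^ e • a + Finsupp.equivFunOnFinite.symm fun _ => p ^ e - 1) 1) =
        monomial a 1 := by
  have hp : p.Prime := Fact.out
  have hpos : ∀ e, 0 < p ^ e := fun e => pow_pos hp.pos e
  induction e with
  | zero => 
    refine ⟨AddMonoidHom.id _, fun r g => by simp, fun a => ?_⟩
    have : (Finsupp.equivFunOnFinite.symm fun _ => p ^ 0 - 1 : σ →₀ ℕ) = 0 := by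
      ext; simp
    rw [this]
    simp
  | succ e ih =>
    obtain ⟨Ψ, hΨ, hΨ'⟩ := ih
    -- Over a perfect field the p-th root is p⁻¹-linear; with all remainders equal to p - 1 the
    -- associated operator is the trace map, which is composed with itself.
    let π : K →+ K := (frobeniusEquiv K p).symm.toAddMonoidHom
    have hπ : IsCartierLinear p π := fun r g => by
      change (frobeniusEquiv K p).symm (r ^ p * g) = r * (frobeniusEquiv K p).symm g
      rw [map_mul, frobeniusEquiv_symm_pow]
    let α : σ →₀ ℕ := Finsupp.equivFunOnFinite.symm fun _ => p - 1
    have hα : ∀ i, α i < p := fun i => Nat.sub_lt hp.pos one_pos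
    refine ⟨(cartier hp.pos π α).comp Ψ, fun r g => ?_, fun a => ?_⟩
    · change cartier hp.pos π α (Ψ (r ^ p ^ (e + 1) * g)) = _
      rw [pow_succ', pow_mul, hΨ, isCartierLinear_cartier hπ hα]
      rfl
    · have : (p ^ (e + 1) • a + Finsupp.equivFunOnFinite.symm fun _ => p ^ (e + 1) - 1) =
          p ^ e • (p • a + α) + Finsupp.equivFunOnFinite.symm fun _ => p ^ e - 1 := by
        ext i
        have h1 := hpos e
        have h2 : p ^ e ≤ p ^ e * p := Nat.le_mul_of_pos_right _ hp.pos
        simp only [Finsupp.coe_add, Finsupp.coe_smul, Pi.add_apply, Pi.smul_apply, smul_eq_mul,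
          Finsupp.equivFunOnFinite_symm_apply_apply, α, mul_add, pow_succ, Nat.mul_sub, mul_one,
          mul_assoc]
        omega
      change cartier hp.pos π α (Ψ _) = _
      rw [this, hΨ']
      classical
      ext γ
      rw [coeff_cartier, coeff_monomial, coeff_monomial]
      by_cases h : a = γ
      · rw [if_pos h, if_pos (by rw [h])]
        exact map_one (frobeniusEquiv K p).symm
      · rw [if_neg h, if_neg, map_zero]
        exact fun h' => h (smul_add_injective hp.pos α h')

variable {K : Type*} [Field K] {N : ℕ}

theorem homogeneousComponent_mul_of_isHomogeneous {σ : Type*} {F g : MvPolynomial σ K} {D j : ℕ}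
    (hF : F.IsHomogeneous D) (h : D ≤ j) :
    homogeneousComponent j (F * g) = F * homogeneousComponent (j - D) g := by
  let _ : GradedAlgebra (homogeneousSubmodule σ K) := gradedAlgebra
  have := DirectSum.coe_decompose_mul_of_left_mem_of_le (homogeneousSubmodule σ K)
    (b := g) (n := j) ((mem_homogeneousSubmodule D F).mpr hF) h
  rw [← decomposition.decompose'_apply, ← decomposition.decompose'_apply]
  exact this

/-- Each factor `F i` split off lowers the degree by exactly D, and the cofactor stays in the ideal
while its degree is at least s. The loss s is paid only once, which makes the estimate sharp for
large powers. -/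
theorem mem_span_pow_of_isHomogeneous {σ ι : Type*} [Finite ι] {F : ι → MvPolynomial σ K} {D s : ℕ}
    (hF : ∀ i, (F i).IsHomogeneous D) (hs : idealOfVars σ K ^ s ≤ Ideal.span (Set.range F))
    (l : ℕ) {g : MvPolynomial σ K} {j : ℕ} (hg : g.IsHomogeneous j) (hj : s + D * l ≤ j) :
    g ∈ Ideal.span (Set.range F) ^ (l + 1) := by
  have := Fintype.ofFinite ι
  have hmem : ∀ {g : MvPolynomial σ K} {j : ℕ}, g.IsHomogeneous j → s ≤ j →
      g ∈ Ideal.span (Set.range F) := by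
    intro g j hg hj
    refine hs ((mem_pow_idealOfVars_iff s g).mpr fun x hx => ?_)
    rw [Finsupp.degree_eq_weight_one]
    exact hj.trans (hg (mem_support_iff.mp hx)).ge
  induction l generalizing g j with
  | zero =>
    rw [zero_add, pow_one]
    exact hmem hg (by omega)
  | succ l ih =>
    obtain ⟨c, hc⟩ := Ideal.mem_span_range_iff_exists_fun.mp (hmem hg (by omega))
    have hD : D ≤ j := by
      rw [mul_add] at hj
      omega
    have h1 : g = ∑ i, homogeneousComponent (j - D) (c i) * F i := by
      have h2 : homogeneousComponent j g = g := by rw [homogeneousComponent_of_mem hg, if_pos rfl]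
      conv_lhs => rw [← h2, ← hc, map_sum]
      refine Finset.sum_congr rfl fun i _ => ?_
      rw [mul_comm, homogeneousComponent_mul_of_isHomogeneous (hF i) hD, mul_comm]
    rw [h1, pow_succ]
    refine Ideal.sum_mem _ fun i _ => Ideal.mul_mem_mul (ih (homogeneousComponent_isHomogeneous _ _)
      ?_) (Ideal.subset_span ⟨i, rfl⟩)
    rw [mul_add] at hj
    omega

/-- Pigeonhole principle for powers of an ideal with `N` generators. -/
theorem _root_.Ideal.span_range_pow_le {R : Type*} [CommRing R] (F : Fin N → R) (q : ℕ) :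
    Ideal.span (Set.range F) ^ (N * (q - 1) + 1) ≤ Ideal.span (Set.range fun i => F i ^ q) := by
  intro y hy
  obtain ⟨P, hP, rfl⟩ := (Ideal.mem_span_pow_iff_exists_isHomogeneous F y).mp hy
  rw [eval_eq']
  refine Ideal.sum_mem _ fun d hd => Ideal.mul_mem_left _ _ ?_
  have hdeg : ∑ i, d i = N * (q - 1) + 1 := by
    rw [← hP (mem_support_iff.mp hd), ← Finsupp.degree_eq_sum, Finsupp.degree_eq_weight_one]
    rfl
  obtain ⟨i, hi⟩ : ∃ i, q ≤ d i := by
    by_contra! h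
    have : ∑ i, d i ≤ ∑ _i : Fin N, (q - 1) := Finset.sum_le_sum fun i _ => by
      have := h i
      omega
    rw [Finset.sum_const, Finset.card_univ, Fintype.card_fin, smul_eq_mul] at this
    omega
  refine Ideal.mem_of_dvd _ ((pow_dvd_pow (F i) hi).trans
    (Finset.dvd_prod_of_mem (fun i => F i ^ d i) (Finset.mem_univ i))) (Ideal.subset_span ⟨i, rfl⟩)

/-- If `N` forms of degree `D` in `N` variables generate an ideal that contains a power of the
maximal ideal, it contains all monomials of degree `> N (D - 1)`. -/
theorem monomial_mem_span_of_lt_degree (p : ℕ) [Fact p.Prime] [CharP K p] [PerfectRing K p]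
    {F : Fin N → MvPolynomial (Fin N) K} {D s : ℕ} (hD : 0 < D)
    (hF : ∀ i, (F i).IsHomogeneous D)
    (hs : idealOfVars (Fin N) K ^ s ≤ Ideal.span (Set.range F))
    {a : Fin N →₀ ℕ} (ha : N * (D - 1) < a.degree) :
    monomial a 1 ∈ Ideal.span (Set.range F) := by
  have hp : p.Prime := Fact.out
  -- For q this large, x^(qa+q-1) has degree at least s + D N (q - 1), so it lies in (F)^(N(q-1)+1),
  -- hence in the ideal of the q-th powers of the forms. The q⁻¹-linear map Ψ then returns x^a ∈
  -- (F).
  obtain ⟨e, he⟩ : ∃ e, s + N ≤ p ^ e := ⟨s + N, (Nat.lt_pow_self hp.one_lt).le⟩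
  obtain ⟨Ψ, hΨ, hΨ'⟩ := exists_iterated_trace (σ := Fin N) (K := K) p e
  set q := p ^ e with hq
  have hq0 : 0 < q := pow_pos hp.pos e
  set b : Fin N →₀ ℕ := q • a + Finsupp.equivFunOnFinite.symm fun _ => q - 1 with hb
  have hbdeg : b.degree = q * a.degree + N * (q - 1) := by
    rw [hb, map_add, map_nsmul, smul_eq_mul]
    congr 1
    rw [Finsupp.degree_eq_sum]
    simp
  have h1 : (monomial b 1 : MvPolynomial (Fin N) K) ∈
      Ideal.span (Set.range fun i => F i ^ q) := by
    refine Ideal.span_range_pow_le F q (mem_span_pow_of_isHomogeneous hF hs (N * (q - 1))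
      (isHomogeneous_monomial (1 : K) rfl) ?_)
    rw [hbdeg]
    obtain ⟨D, rfl⟩ : ∃ D', D = D' + 1 := ⟨D - 1, by omega⟩
    obtain ⟨q', hq'⟩ : ∃ q', q = q' + 1 := ⟨q - 1, by omega⟩
    have h2 : q * (N * D + 1) ≤ q * a.degree := Nat.mul_le_mul_left _ (by simpa using ha)
    rw [hq'] at h2 he ⊢
    simp only [Nat.add_sub_cancel]
    nlinarith
  obtain ⟨c, hc⟩ := Ideal.mem_span_range_iff_exists_fun.mp h1
  rw [← hΨ' a, ← hb, ← hc, map_sum]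
  refine Ideal.sum_mem _ fun i _ => ?_
  rw [mul_comm, hΨ]
  exact Ideal.mul_mem_right _ _ (Ideal.subset_span ⟨i, rfl⟩)

end Socle

/-! ### Reduction to N forms by generic projection. -/

section Projection

variable {K : Type*} [Field K]

theorem aeval_smul_of_isHomogeneous {τ A : Type*} [Fintype τ] [CommRing A] [Algebra K A]
    {H : MvPolynomial τ K} {δ : ℕ} (hH : H.IsHomogeneous δ) (c : τ → K) (g : A) :
    aeval (fun i => c i • g) H = eval c H • g ^ δ := by
  rw [aeval_def, eval₂_eq', eval_eq', Finset.sum_smul]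
  refine Finset.sum_congr rfl fun d hd => ?_
  have hdeg : ∑ i, d i = δ := by
    rw [← hH (mem_support_iff.mp hd), ← Finsupp.degree_eq_sum, Finsupp.degree_eq_weight_one]
    rfl
  simp only [smul_pow]
  rw [Finset.prod_smul, Finset.prod_pow_eq_pow_sum, hdeg, mul_smul, Algebra.smul_def (coeff d H)]

/-- `L > N` forms of the same degree in `N` variables satisfy a homogeneous relation. -/
theorem exists_isHomogeneous_aeval_eq_zero {N L D : ℕ} (hD : 0 < D) (hL : N < L)
    {G : Fin L → MvPolynomial (Fin N) K} (hG : ∀ i, (G i).IsHomogeneous D) :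
    ∃ (H : MvPolynomial (Fin L) K) (δ : ℕ), H ≠ 0 ∧ H.IsHomogeneous δ ∧ aeval G H = 0 := by
  have hdep : ¬ AlgebraicIndependent K G := by
    intro h
    have := h.lift_cardinalMk_le_trdeg
    -- The transcendence degree N of the polynomial ring is too small for L independent elements.
    rw [MvPolynomial.trdeg_of_isDomain] at this
    simp at this
    omega
  rw [algebraicIndependent_iff] at hdep
  push Not at hdep
  obtain ⟨H, hH, hH0⟩ := hdep
  obtain ⟨d, hd⟩ := ne_zero_iff.mp hH0
  refine ⟨homogeneousComponent d.degree H, d.degree, ?_, homogeneousComponent_isHomogeneous _ _, ?_⟩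
  · intro h
    have := congrArg (coeff d) h
    rw [coeff_homogeneousComponent, if_pos rfl, coeff_zero] at this
    exact hd this
  · have h1 : ∀ j, homogeneousComponent (D * d.degree) (aeval G (homogeneousComponent j H)) =
        if j = d.degree then aeval G (homogeneousComponent d.degree H) else 0 := by
      intro j
      rw [homogeneousComponent_of_mem ((homogeneousComponent_isHomogeneous j H).aeval G hG)]
      by_cases hj : j = d.degree
      · rw [if_pos hj, if_pos (by rw [hj]), hj]
      · rw [if_neg hj, if_neg fun h => hj (Nat.eq_of_mul_eq_mul_left hD h).symm]
    have h2 := congrArg (homogeneousComponent (D * d.degree)) hH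
    rw [← sum_homogeneousComponent H, map_sum, map_sum, map_zero] at h2
    simp only [h1] at h2
    rw [Finset.sum_ite_eq', if_pos] at h2
    · exact h2
    · rw [Finset.mem_range, Nat.lt_succ_iff]
      exact le_totalDegree (mem_support_iff.mpr hd)

/-- Among `L > N` forms of the same degree over an infinite field, one can be eliminated without
changing the radical. -/
theorem exists_forms_of_lt [Infinite K] {N L D : ℕ} (hD : 0 < D) (hL : N < L + 1)
    {G : Fin (L + 1) → MvPolynomial (Fin N) K} (hG : ∀ i, (G i).IsHomogeneous D) :
    ∃ G' : Fin L → MvPolynomial (Fin N) K, (∀ i, (G' i).IsHomogeneous D) ∧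
      (∀ i, G' i ∈ Ideal.span (Set.range G)) ∧
      ∀ i, G i ∈ (Ideal.span (Set.range G')).radical := by
  obtain ⟨H, δ, hH0, hH, hHG⟩ := exists_isHomogeneous_aeval_eq_zero hD hL hG
  obtain ⟨c, hc⟩ : ∃ c, eval c H ≠ 0 := by
    by_contra! h
    exact hH0 (MvPolynomial.funext fun x => by rw [h x, map_zero])
  -- The point c is not the origin: a form of positive degree vanishes there, and a nonzero constant
  -- cannot be a relation.
  obtain ⟨i₀, hi₀⟩ : ∃ i, c i ≠ 0 := by
    by_contra! h
    have hδ : δ ≠ 0 := by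
      rintro rfl
      have h2 := totalDegree_eq_zero_iff_eq_C.mp (Nat.le_zero.mp hH.totalDegree_le)
      rw [h2, aeval_C] at hHG
      rw [h2, eval_C] at hc
      exact hc ((map_eq_zero_iff _ (C_injective _ _)).mp hHG)
    have h4 := aeval_smul_of_isHomogeneous hH (1 : Fin (L + 1) → K) (0 : K)
    rw [zero_pow hδ, smul_zero] at h4
    refine hc ?_
    rw [← coe_aeval_eq_eval, ← h4]
    have : c = fun i => (1 : Fin (L + 1) → K) i • (0 : K) := by
      funext i
      rw [h i, smul_zero]
    rw [← this]
    rfl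
  -- Projection from the point c, which lies off the hypersurface H = 0. Modulo the new forms every
  -- G_i equals (c_i / c_{i₀}) G_{i₀}, so the relation becomes a nonzero scalar times G_{i₀}^δ and
  -- G_{i₀} is nilpotent.
  refine ⟨fun i => G (i₀.succAbove i) - (c (i₀.succAbove i) / c i₀) • G i₀, fun i => ?_,
    fun i => ?_, ?_⟩
  · exact (hG _).sub ((homogeneousSubmodule (Fin N) K D).smul_mem _ (hG i₀))
  · dsimp only
    rw [smul_eq_C_mul]
    exact Ideal.sub_mem _ (Ideal.subset_span ⟨_, rfl⟩)
      (Ideal.mul_mem_left _ _ (Ideal.subset_span ⟨_, rfl⟩))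
  · set J := Ideal.span (Set.range fun i : Fin L =>
      G (i₀.succAbove i) - (c (i₀.succAbove i) / c i₀) • G i₀) with hJ
    have hdiff : ∀ i, G i - (c i / c i₀) • G i₀ ∈ J := by
      intro i
      rcases eq_or_ne i i₀ with rfl | hi
      · rw [div_self hi₀, one_smul, sub_self]
        exact J.zero_mem
      · obtain ⟨j, rfl⟩ := Fin.exists_succAbove_eq hi
        exact Ideal.subset_span ⟨j, rfl⟩
    have hrad : G i₀ ^ δ ∈ J := by
      have hmk : ∀ i, Ideal.Quotient.mkₐ K J (G i) = c i • ((c i₀)⁻¹ • Ideal.Quotient.mkₐ K J (G i₀)) := by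
        intro i
        rw [smul_smul, ← div_eq_mul_inv, ← map_smul, ← sub_eq_zero, ← map_sub]
        exact Ideal.Quotient.eq_zero_iff_mem.mpr (hdiff i)
      have h1 := congrArg (Ideal.Quotient.mkₐ K J) hHG
      rw [map_zero, ← AlgHom.comp_apply, comp_aeval] at h1
      rw [show (fun i => Ideal.Quotient.mkₐ K J (G i)) = fun i => _ from _root_.funext hmk,
        aeval_smul_of_isHomogeneous hH, smul_pow, smul_smul, ← map_pow] at h1
      have hu : eval c H * (c i₀)⁻¹ ^ δ ≠ 0 := mul_ne_zero hc (pow_ne_zero _ (inv_ne_zero hi₀))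
      exact Ideal.Quotient.eq_zero_iff_mem.mp ((smul_eq_zero_iff_right hu).mp h1)
    have h0 : G i₀ ∈ J.radical := ⟨δ, hrad⟩
    intro i
    rw [← sub_add_cancel (G i) ((c i / c i₀) • G i₀), smul_eq_C_mul]
    refine Ideal.add_mem _ (Ideal.le_radical ?_) (Ideal.mul_mem_left _ _ h0)
    rw [← smul_eq_C_mul]
    exact hdiff i

/-- Homogeneous systems of parameters: the radical of an ideal generated by forms of degree `D` in
`N` variables over an infinite field is the radical of an ideal with `N` such generators. -/
theorem exists_forms_radical [Infinite K] {N D : ℕ} (hD : 0 < D) (L : ℕ)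
    {G : Fin L → MvPolynomial (Fin N) K} (hG : ∀ i, (G i).IsHomogeneous D) :
    ∃ F : Fin N → MvPolynomial (Fin N) K, (∀ i, (F i).IsHomogeneous D) ∧
      (∀ i, F i ∈ Ideal.span (Set.range G)) ∧
      ∀ i, G i ∈ (Ideal.span (Set.range F)).radical := by
  induction L with
  | zero =>
    exact ⟨0, fun i => isHomogeneous_zero _ _ _, fun i => Ideal.zero_mem _, fun i => i.elim0⟩
  | succ L ih =>
    by_cases hL : N < L + 1
    · obtain ⟨G', h1, h2, h3⟩ := exists_forms_of_lt hD hL hG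
      obtain ⟨F, h4, h5, h6⟩ := ih h1
      have hle : Ideal.span (Set.range G') ≤ Ideal.span (Set.range G) := by
        rw [Ideal.span_le, Set.range_subset_iff]
        exact h2
      refine ⟨F, h4, fun i => hle (h5 i), fun i => ?_⟩
      have hle' : Ideal.span (Set.range G') ≤ (Ideal.span (Set.range F)).radical := by
        rw [Ideal.span_le, Set.range_subset_iff]
        exact h6
      rw [← Ideal.radical_idem]
      exact Ideal.radical_mono hle' (h3 i)
    -- With at most N forms nothing has to be eliminated; the family is padded with zeros.
    · refine ⟨fun i => if h : i.1 < L + 1 then G ⟨i, h⟩ else 0, fun i => ?_, fun i => ?_,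
        fun i => Ideal.le_radical (Ideal.subset_span ⟨⟨i, by omega⟩, ?_⟩)⟩
      · dsimp only
        split_ifs
        · exact hG _
        · exact isHomogeneous_zero _ _ _
      · dsimp only
        split_ifs
        · exact Ideal.subset_span ⟨_, rfl⟩
        · exact Ideal.zero_mem _
      · exact dif_pos i.2

end Projection

/-! ### Descent from the algebraic closure. -/

section Descent

/-- Extension of coefficients to a larger field is faithful on ideals. -/
theorem mem_span_of_map_mem_span {σ ι k K : Type*} [Finite ι] [Field k] [Field K] [Algebra k K]
    {g : ι → MvPolynomial σ k} {h : MvPolynomial σ k}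
    (hh : map (algebraMap k K) h ∈ Ideal.span (Set.range fun i => map (algebraMap k K) (g i))) :
    h ∈ Ideal.span (Set.range g) := by
  classical
  have := Fintype.ofFinite ι
  -- A k-linear retraction K → k, applied to coefficients, is linear over k[x] and carries a
  -- representation over K to one over k.
  obtain ⟨ρ, hρ⟩ := LinearMap.exists_leftInverse_of_injective (Algebra.linearMap k K)
    (LinearMap.ker_eq_bot.mpr (algebraMap k K).injective)
  obtain ⟨c, hc⟩ := Ideal.mem_span_range_iff_exists_fun.mp hh
  let T : MvPolynomial σ K → MvPolynomial σ k := fun x => AddMonoidAlgebra.map ρ.toAddMonoidHom x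
  have hT : ∀ x m, coeff m (T x) = ρ (coeff m x) := fun x m => by simp [T, coeff]
  have h1 : h = ∑ i, T (c i) * g i := by
    ext m
    have h2 := congrArg (fun x => ρ (coeff m x)) hc
    simp only [coeff_sum, coeff_mul, coeff_map, map_sum] at h2 ⊢
    have hρ1 : ρ (algebraMap k K (coeff m h)) = coeff m h := LinearMap.congr_fun hρ _
    rw [← hρ1, ← h2]
    refine Finset.sum_congr rfl fun i _ => Finset.sum_congr rfl fun x _ => ?_
    rw [mul_comm, ← Algebra.smul_def, map_smul, hT, smul_eq_mul, mul_comm]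
  rw [h1]
  exact Ideal.sum_mem _ fun i _ => Ideal.mul_mem_left _ _ (Ideal.subset_span ⟨i, rfl⟩)

end Descent

/-- An ideal generated by forms of degrees at most `D` in `N` variables that contains a power of
the maximal ideal contains all monomials of degree `> N (D - 1)`. -/
theorem monomial_mem_span_of_pow_le {k : Type*} [Field k] (p : ℕ) [Fact p.Prime] [CharP k p]
    {N D s : ℕ} (hD : 0 < D) {ι : Type*} [Finite ι] {g : ι → MvPolynomial (Fin N) k}
    (hg : ∀ i, ∃ m ≤ D, (g i).IsHomogeneous m)
    (hs : idealOfVars (Fin N) k ^ s ≤ Ideal.span (Set.range g))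
    {a : Fin N →₀ ℕ} (ha : N * (D - 1) < a.degree) :
    monomial a 1 ∈ Ideal.span (Set.range g) := by
  -- The closure is infinite, as projection requires, and perfect, as the trace map requires.
  let K := AlgebraicClosure k
  have : CharP K p := charP_of_injective_algebraMap (algebraMap k K).injective p
  choose m hm hgm using hg
  obtain ⟨L, ⟨en⟩⟩ : ∃ L, Nonempty (Fin L ≃ ι × Fin N) := by
    have := Fintype.ofFinite (ι × Fin N)
    exact ⟨_, ⟨(Fintype.equivFin _).symm⟩⟩
  -- Multiplying by all powers X_j^(D-m) brings the generators to the common degree D. The zero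
  -- locus outside the origin is unchanged: a prime that misses X_j and contains the g_i X_j^(D-m)
  -- contains every g_i.
  let G : Fin L → MvPolynomial (Fin N) K := fun l =>
    map (algebraMap k K) (g (en l).1) * X (en l).2 ^ (D - m (en l).1)
  have hG : ∀ l, (G l).IsHomogeneous D := by
    intro l
    have := ((hgm (en l).1).map (algebraMap k K)).mul
      ((isHomogeneous_X K (en l).2).pow (D - m (en l).1))
    rwa [one_mul, Nat.add_sub_cancel' (hm _)] at this
  obtain ⟨F, hF, hFG, hGF⟩ := exists_forms_radical hD L hG
  have hGK : Ideal.span (Set.range G) ≤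
      Ideal.span (Set.range fun i => map (algebraMap k K) (g i)) := by
    rw [Ideal.span_le, Set.range_subset_iff]
    exact fun l => Ideal.mul_mem_right _ _ (Ideal.subset_span ⟨_, rfl⟩)
  have hFK : Ideal.span (Set.range F) ≤
      Ideal.span (Set.range fun i => map (algebraMap k K) (g i)) := by
    rw [Ideal.span_le, Set.range_subset_iff]
    exact fun i => hGK (hFG i)
  obtain ⟨s', hs'⟩ : ∃ s', idealOfVars (Fin N) K ^ s' ≤ Ideal.span (Set.range F) := by
    refine Ideal.exists_pow_le_of_le_radical_of_fg ?_ (idealOfVars_fg _ _)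
    rw [idealOfVars, Ideal.span_le, Set.range_subset_iff]
    intro j
    change X j ∈ (Ideal.span (Set.range F)).radical
    rw [Ideal.radical_eq_sInf, Ideal.mem_sInf]
    rintro Q ⟨hQ, hQp⟩
    by_contra hj
    have hgQ : ∀ i, map (algebraMap k K) (g i) ∈ Q := by
      intro i
      have h1 : G (en.symm (i, j)) ∈ Q := (hQp.radical_le_iff.mpr hQ) (hGF _)
      refine (hQp.mem_or_mem h1).elim (fun h => by simpa using h) fun h => ?_
      simp only [Equiv.apply_symm_apply] at h
      exact absurd (hQp.mem_of_pow_mem _ h) hj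
    have h2 : (X j : MvPolynomial (Fin N) k) ^ s ∈ Ideal.span (Set.range g) :=
      hs (Ideal.pow_mem_pow (Ideal.subset_span (Set.mem_range_self j)) s)
    have h3 := Ideal.mem_map_of_mem (map (algebraMap k K)) h2
    rw [Ideal.map_span, map_pow, map_X] at h3
    have h4 : Ideal.span (map (algebraMap k K) '' Set.range g) ≤ Q := by
      rw [Ideal.span_le]
      rintro _ ⟨_, ⟨i, rfl⟩, rfl⟩
      exact hgQ i
    exact hj (hQp.mem_of_pow_mem s (h4 h3))
  refine mem_span_of_map_mem_span (K := K) ?_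
  rw [map_monomial, map_one]
  exact hFK (monomial_mem_span_of_lt_degree p hD hF hs' ha)

end MvPolynomial

/-! ### Powers of the variables and their Koszul syzygies. -/

namespace MvPolynomial

variable {σ k : Type*} [Field k]

/-- The ideal generated by the `t`-th powers of the variables in `S`. -/
noncomputable def powIdeal (k : Type*) [Field k] (t : ℕ) (S : Set σ) : Ideal (MvPolynomial σ k) :=
  Ideal.span ((fun i => (X i : MvPolynomial σ k) ^ t) '' S)

theorem mem_powIdeal_iff {t : ℕ} {S : Set σ} {g : MvPolynomial σ k} :
    g ∈ powIdeal k t S ↔ ∀ b ∈ g.support, ∃ i ∈ S, t ≤ b i := by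
  have h : powIdeal k t S =
      Ideal.span ((fun s => monomial s (1 : k)) '' ((fun i => Finsupp.single i t) '' S)) := by
    rw [powIdeal, Set.image_image]
    simp only [X_pow_eq_monomial]
  rw [h, mem_ideal_span_monomial_image]
  simp

/-- H^{n+1}(R) is the direct limit of the R/(x_i^t) under multiplication by powers of the product of
the variables; this is injectivity of the transition maps. -/
theorem mem_powIdeal_univ_of_monomial_mul_mem {t : ℕ} {c : σ →₀ ℕ} {g : MvPolynomial σ k}
    {s : ℕ} (hc : ∀ i, c i = s)
    (h : monomial c 1 * g ∈ powIdeal k (t + s) Set.univ) : g ∈ powIdeal k t Set.univ := by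
  rw [mem_powIdeal_iff] at h ⊢
  intro b hb
  obtain ⟨i, hi, h1⟩ := h (c + b) (by
    rw [mem_support_iff, coeff_monomial_mul, one_mul]
    exact mem_support_iff.mp hb)
  refine ⟨i, hi, ?_⟩
  rw [Finsupp.add_apply, hc] at h1
  omega

/-- Powers of distinct variables form a regular sequence in any order. -/
theorem mem_powIdeal_of_mul_X_pow_mem {t : ℕ} {S : Set σ} {j : σ} (hj : j ∉ S)
    {g : MvPolynomial σ k} (h : g * X j ^ t ∈ powIdeal k t S) : g ∈ powIdeal k t S := by
  rw [mem_powIdeal_iff] at h ⊢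
  intro b hb
  rw [X_pow_eq_monomial] at h
  obtain ⟨i, hi, h1⟩ := h (b + Finsupp.single j t) (by
    rw [mem_support_iff, coeff_mul_monomial, mul_one]
    exact mem_support_iff.mp hb)
  refine ⟨i, hi, ?_⟩
  have hij : j ≠ i := fun h => hj (h ▸ hi)
  rwa [Finsupp.add_apply, Finsupp.single_eq_of_ne' hij, add_zero] at h1

/-- The syzygies of powers of the variables are generated by the Koszul syzygies. -/
theorem mem_span_koszul_of_sum_eq_zero [LinearOrder σ] [Fintype σ] (t : ℕ) (S : Finset σ)
    {g : σ → MvPolynomial σ k} (hS : ∀ i ∉ S, g i = 0) (hg : ∑ i, g i * X i ^ t = 0) :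
    g ∈ Submodule.span (MvPolynomial σ k) {v | ∃ i j, i < j ∧
      v = (X j ^ t : MvPolynomial σ k) • Pi.single i (1 : MvPolynomial σ k) -
        (X i ^ t : MvPolynomial σ k) • Pi.single j (1 : MvPolynomial σ k)} := by
  classical
  set W := Submodule.span (MvPolynomial σ k) {v | ∃ i j, i < j ∧
      v = (X j ^ t : MvPolynomial σ k) • Pi.single i (1 : MvPolynomial σ k) -
        (X i ^ t : MvPolynomial σ k) • Pi.single j (1 : MvPolynomial σ k)} with hW
  have hgen : ∀ i j, (X j ^ t : MvPolynomial σ k) • Pi.single i (1 : MvPolynomial σ k) -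
        (X i ^ t : MvPolynomial σ k) • Pi.single j (1 : MvPolynomial σ k) ∈ W := by
    intro i j
    rcases lt_trichotomy i j with h | rfl | h
    · exact Submodule.subset_span ⟨i, j, h, rfl⟩
    · rw [sub_self]
      exact W.zero_mem
    · rw [← neg_sub]
      exact W.neg_mem (Submodule.subset_span ⟨j, i, h, rfl⟩)
  induction S using Finset.induction_on generalizing g with
  | empty =>
    rw [show g = 0 from _root_.funext fun i => hS i (by simp)]
    exact W.zero_mem
  | insert j S hj ih =>
    have h1 : g j * X j ^ t ∈ powIdeal k t (S : Set σ) := by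
      rw [← Finset.add_sum_erase _ _ (Finset.mem_univ j)] at hg
      rw [eq_neg_of_add_eq_zero_left hg]
      refine neg_mem (Ideal.sum_mem _ fun i hi => ?_)
      by_cases hiS : i ∈ S
      · exact Ideal.mul_mem_left _ _ (Ideal.subset_span ⟨i, hiS, rfl⟩)
      · rw [hS i (by simp [hiS, (Finset.mem_erase.mp hi).1]), zero_mul]
        exact Ideal.zero_mem _
    have h2 := mem_powIdeal_of_mul_X_pow_mem (by simpa using hj) h1
    obtain ⟨a, ha⟩ : ∃ a : σ → MvPolynomial σ k, ∑ i ∈ S, a i • (X i : MvPolynomial σ k) ^ t =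
        g j := by
      obtain ⟨a, ha⟩ := (Submodule.mem_span_image_finset_iff_exists_fun _).mp h2
      refine ⟨fun i => if h : i ∈ S then a ⟨i, h⟩ else 0, ?_⟩
      rw [← ha, ← Finset.sum_coe_sort S]
      exact Finset.sum_congr rfl fun i _ => by simp
    -- By regularity g_j is a combination of the remaining powers; this combination of Koszul
    -- relations has the same j-th entry as g, so subtracting it removes j from the support.
    set v : σ → MvPolynomial σ k := ∑ i ∈ S, a i •
      ((X i ^ t : MvPolynomial σ k) • Pi.single j (1 : MvPolynomial σ k) -
        (X j ^ t : MvPolynomial σ k) • Pi.single i (1 : MvPolynomial σ k)) with hv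
    have hvW : v ∈ W := W.sum_mem fun i _ => W.smul_mem _ (hgen j i)
    rw [← sub_add_cancel g v]
    refine W.add_mem (ih ?_ ?_) hvW
    · intro i hi
      by_cases hij : i = j
      · subst hij
        rw [Pi.sub_apply, ← ha, hv, Finset.sum_apply, sub_eq_zero]
        refine Finset.sum_congr rfl fun l hl => ?_
        have : i ≠ l := fun h => hi (h ▸ hl)
        simp [this]
      · rw [Pi.sub_apply, hS i (by simp [hi, hij]), hv, Finset.sum_apply, zero_sub, neg_eq_zero]
        refine Finset.sum_eq_zero fun l hl => ?_
        have : i ≠ l := fun h => hi (h ▸ hl)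
        simp [this, hij]
    · have : ∑ i, v i * X i ^ t = 0 := by
        simp only [hv, Finset.sum_apply, Finset.sum_mul]
        rw [Finset.sum_comm]
        refine Finset.sum_eq_zero fun l _ => ?_
        simp only [Pi.smul_apply, Pi.sub_apply, Pi.single_apply, smul_eq_mul, mul_ite, mul_one,
          mul_zero, mul_sub, sub_mul, ite_mul, zero_mul, Finset.sum_sub_distrib,
          Finset.sum_ite_eq', Finset.mem_univ, if_true]
        ring
      simp only [Pi.sub_apply, sub_mul, Finset.sum_sub_distrib, hg, this, sub_zero]

end MvPolynomial

/-! ### The Čech complex in terms of numerators over a common denominator. -/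

namespace Cech

/-- The sign of `j` in the Čech differential. -/
def sign {m : ℕ} (j : Fin m) (J : Finset (Fin m)) : ℤ := (-1) ^ (J.filter (· < j)).card

theorem sign_mul_self {m : ℕ} (j : Fin m) (J : Finset (Fin m)) : sign j J * sign j J = 1 := by
  rw [sign, ← pow_add, ← two_mul, pow_mul, neg_one_sq, one_pow]

theorem sign_erase_of_lt {m : ℕ} {i j : Fin m} (h : i < j) (J : Finset (Fin m)) :
    sign i (J.erase j) = sign i J := by
  rw [sign, sign, Finset.filter_erase, Finset.erase_eq_of_notMem]
  simp [h.not_gt]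

theorem sign_erase_of_gt {m : ℕ} {i j : Fin m} (h : i < j) {J : Finset (Fin m)} (hi : i ∈ J) :
    sign j (J.erase i) = - sign j J := by
  have hmem : i ∈ J.filter (· < j) := by simp [hi, h]
  rw [sign, sign, Finset.filter_erase, ← Finset.card_erase_add_one hmem, pow_succ]
  ring

theorem sign_mul_sign_erase {m : ℕ} {i j : Fin m} (h : i ≠ j) {J : Finset (Fin m)} (hi : i ∈ J)
    (hj : j ∈ J) :
    sign j J * sign i (J.erase j) = - (sign i J * sign j (J.erase i)) := by
  rcases h.lt_or_gt with h | h
  · rw [sign_erase_of_lt h, sign_erase_of_gt h hi]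
    ring
  · rw [sign_erase_of_lt h, sign_erase_of_gt h hj]
    ring

end Cech

namespace Hypersurface

open MvPolynomial

variable {k : Type u} [Field k] {n : ℕ}

/-- The Čech differential on the numerators of fractions with denominators `x_I ^ t`. -/
noncomputable def numD (t : ℕ) :
    (Finset (Fin (n + 1)) → MvPolynomial (Fin (n + 1)) k) →ₗ[MvPolynomial (Fin (n + 1)) k]
      (Finset (Fin (n + 1)) → MvPolynomial (Fin (n + 1)) k) where
  toFun e J := ∑ j ∈ J, Cech.sign j J • (e (J.erase j) * X j ^ t)
  map_add' e e' := by
    funext J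
    simp only [Pi.add_apply, add_mul, smul_add, Finset.sum_add_distrib]
  map_smul' a e := by
    funext J
    simp only [Pi.smul_apply, smul_eq_mul, RingHom.id_apply, Finset.mul_sum, mul_assoc,
      mul_smul_comm]

theorem numD_apply (t : ℕ) (e : Finset (Fin (n + 1)) → MvPolynomial (Fin (n + 1)) k)
    (J : Finset (Fin (n + 1))) :
    numD t e J = ∑ j ∈ J, Cech.sign j J • (e (J.erase j) * X j ^ t) := rfl

/-- Terms cancel in pairs under exchanging the order in which two indices are removed. -/
theorem numD_numD (t : ℕ) (e : Finset (Fin (n + 1)) → MvPolynomial (Fin (n + 1)) k) :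
    numD t (numD t e) = 0 := by
  funext J
  simp only [numD_apply, Finset.sum_mul, Finset.smul_sum, Pi.zero_apply]
  rw [Finset.sum_sigma']
  refine Finset.sum_involution (fun x _ => ⟨x.2, x.1⟩) ?_ ?_ ?_ ?_
  · rintro ⟨j, i⟩ h
    simp only [Finset.mem_sigma, Finset.mem_erase] at h
    obtain ⟨hj, hij, hi⟩ := h
    dsimp only
    have h1 := Cech.sign_mul_sign_erase hij hi hj
    rw [Finset.erase_right_comm, smul_mul_assoc, smul_mul_assoc, smul_smul, smul_smul, h1,
      neg_smul, mul_right_comm, neg_add_cancel]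
  · rintro ⟨j, i⟩ h _ h'
    simp only [Finset.mem_sigma, Finset.mem_erase] at h
    simp only [Sigma.mk.injEq] at h'
    exact h.2.1 h'.1
  · rintro ⟨j, i⟩ h
    simp only [Finset.mem_sigma, Finset.mem_erase] at h ⊢
    exact ⟨h.2.2, h.2.1.symm, h.1⟩
  · rintro ⟨j, i⟩ h
    rfl

/-- The monomial `x_I`. -/
noncomputable def xprod (k : Type u) [Field k] (I : Finset (Fin (n + 1))) :
    MvPolynomial (Fin (n + 1)) k := ∏ j ∈ I, X j

theorem xprod_erase_mul {j : Fin (n + 1)} {J : Finset (Fin (n + 1))} (hj : j ∈ J) :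
    xprod k (J.erase j) * X j = xprod k J :=
  Finset.prod_erase_mul J _ hj

/-- The numerator complexes for different t are compatible, so cochains can be compared after
enlarging their denominators. -/
theorem numD_scale (t s : ℕ) (e : Finset (Fin (n + 1)) → MvPolynomial (Fin (n + 1)) k) :
    numD (t + s) (fun I => xprod k I ^ s * e I) = fun J => xprod k J ^ s * numD t e J := by
  funext J
  rw [numD_apply, numD_apply, Finset.mul_sum]
  refine Finset.sum_congr rfl fun j hj => ?_
  rw [mul_smul_comm, ← xprod_erase_mul hj, mul_pow, pow_add]
  congr 1
  ring

theorem numD_pow (p : ℕ) [Fact p.Prime] [CharP k p] (t : ℕ)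
    (e : Finset (Fin (n + 1)) → MvPolynomial (Fin (n + 1)) k) (J : Finset (Fin (n + 1))) :
    numD (p * t) (fun I => e I ^ p) J = numD t e J ^ p := by
  change _ = frobeniusOver k p _ (numD t e J)
  rw [numD_apply, numD_apply, map_sum]
  refine Finset.sum_congr rfl fun j _ => ?_
  rw [map_zsmul]
  change _ = _ • (e (J.erase j) * X j ^ t) ^ p
  rw [mul_pow, ← pow_mul, mul_comm p t]

variable (f : MvPolynomial (Fin (n + 1)) k)

/-- The canonical map `R → (R/fR)_{x_I}`. -/
noncomputable def locMap (I : Finset (Fin (n + 1))) :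
    MvPolynomial (Fin (n + 1)) k →+* Cech.Loc (var f) I :=
  (algebraMap (Quot f) (Cech.Loc (var f) I)).comp (Ideal.Quotient.mk (Ideal.span {f}))

theorem mk_xprod (I : Finset (Fin (n + 1))) :
    Ideal.Quotient.mk (Ideal.span {f}) (xprod k I) = ∏ l ∈ I, var f l :=
  map_prod _ _ _

theorem locMap_xprod (I : Finset (Fin (n + 1))) : locMap f I (xprod k I) =
    algebraMap (Quot f) (Cech.Loc (var f) I) (∏ l ∈ I, var f l) :=
  congrArg (algebraMap (Quot f) (Cech.Loc (var f) I)) (mk_xprod f I)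

theorem isUnit_locMap_xprod (I : Finset (Fin (n + 1))) : IsUnit (locMap f I (xprod k I)) := by
  rw [locMap_xprod]
  exact IsLocalization.Away.algebraMap_isUnit _

/-- The fraction `g / x_I ^ t` in `(R/fR)_{x_I}`. -/
noncomputable def frac (t : ℕ) (I : Finset (Fin (n + 1))) (g : MvPolynomial (Fin (n + 1)) k) :
    Cech.Loc (var f) I := locMap f I g * ↑((isUnit_locMap_xprod f I).unit⁻¹ ^ t)

variable {f}

theorem eq_frac_iff {t : ℕ} {I : Finset (Fin (n + 1))} {g : MvPolynomial (Fin (n + 1)) k}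
    {z : Cech.Loc (var f) I} :
    z = frac f t I g ↔ z * locMap f I (xprod k I) ^ t = locMap f I g := by
  rw [frac, inv_pow, Units.eq_mul_inv_iff_mul_eq, Units.val_pow_eq_pow_val, IsUnit.unit_spec]

theorem frac_mul (t : ℕ) (I : Finset (Fin (n + 1))) (g : MvPolynomial (Fin (n + 1)) k) :
    frac f t I g * locMap f I (xprod k I) ^ t = locMap f I g := eq_frac_iff.mp rfl

theorem frac_scale (t s : ℕ) (I : Finset (Fin (n + 1))) (g : MvPolynomial (Fin (n + 1)) k) :
    frac f (t + s) I (xprod k I ^ s * g) = frac f t I g := by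
  symm
  rw [eq_frac_iff, pow_add, ← mul_assoc, frac_mul, map_mul, map_pow, mul_comm]

theorem frac_add (t : ℕ) (I : Finset (Fin (n + 1))) (g h : MvPolynomial (Fin (n + 1)) k) :
    frac f t I (g + h) = frac f t I g + frac f t I h := by
  simp only [frac, map_add, add_mul]

theorem frac_sub (t : ℕ) (I : Finset (Fin (n + 1))) (g h : MvPolynomial (Fin (n + 1)) k) :
    frac f t I (g - h) = frac f t I g - frac f t I h := by
  simp only [frac, map_sub, sub_mul]

@[simp] theorem frac_zero (t : ℕ) (I : Finset (Fin (n + 1))) : frac f t I 0 = 0 := by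
  simp only [frac, map_zero, zero_mul]

theorem frac_sum {ι : Type*} (s : Finset ι) (t : ℕ) (I : Finset (Fin (n + 1)))
    (g : ι → MvPolynomial (Fin (n + 1)) k) :
    frac f t I (∑ i ∈ s, g i) = ∑ i ∈ s, frac f t I (g i) := by
  simp only [frac, map_sum, Finset.sum_mul]

theorem frac_zsmul (t : ℕ) (I : Finset (Fin (n + 1))) (c : ℤ) (g : MvPolynomial (Fin (n + 1)) k) :
    frac f t I (c • g) = c • frac f t I g := by
  simp only [frac, map_zsmul, smul_mul_assoc]

theorem frac_mul_self (t : ℕ) (I : Finset (Fin (n + 1))) (g : MvPolynomial (Fin (n + 1)) k) :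
    frac f t I (f * g) = 0 := by
  have : locMap f I f = 0 := by
    change algebraMap _ (Cech.Loc (var f) I) (Ideal.Quotient.mk (Ideal.span {f}) f) = 0
    rw [Ideal.Quotient.eq_zero_iff_mem.mpr (Ideal.mem_span_singleton_self f), map_zero]
  rw [frac, map_mul, this, zero_mul, zero_mul]

theorem frac_pow (p t : ℕ) (I : Finset (Fin (n + 1))) (g : MvPolynomial (Fin (n + 1)) k) :
    frac f (p * t) I (g ^ p) = frac f t I g ^ p := by
  symm
  rw [eq_frac_iff, mul_comm p t, pow_mul, ← mul_pow, frac_mul, map_pow]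

/-- The extra power of x_I is needed because x_I may be a zero divisor modulo f. -/
theorem frac_eq_zero_iff {t : ℕ} {I : Finset (Fin (n + 1))} {g : MvPolynomial (Fin (n + 1)) k} :
    frac f t I g = 0 ↔ ∃ s, f ∣ xprod k I ^ s * g := by
  have h1 : frac f t I g = 0 ↔ locMap f I g = 0 := by
    rw [frac, Units.mul_left_eq_zero]
  rw [h1]
  constructor
  · intro h
    obtain ⟨⟨_, s, rfl⟩, h⟩ := (IsLocalization.map_eq_zero_iff
      (Submonoid.powers (∏ l ∈ I, var f l)) (Cech.Loc (var f) I) _).mp h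
    refine ⟨s, ?_⟩
    change (∏ l ∈ I, var f l) ^ s * Ideal.Quotient.mk (Ideal.span {f}) g = 0 at h
    rwa [← mk_xprod, ← map_pow, ← map_mul, Ideal.Quotient.eq_zero_iff_mem,
      Ideal.mem_span_singleton] at h
  · rintro ⟨s, c, hc⟩
    have h2 := frac_mul_self (f := f) 0 I c
    rw [← hc] at h2
    rw [← (isUnit_locMap_xprod f I).pow s |>.mul_right_eq_zero]
    simpa [frac] using h2

theorem exists_eq_frac {I : Finset (Fin (n + 1))} (z : Cech.Loc (var f) I) :
    ∃ t g, z = frac f t I g := by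
  obtain ⟨t, a, h⟩ := IsLocalization.Away.surj (∏ l ∈ I, var f l) z
  obtain ⟨g, rfl⟩ := Ideal.Quotient.mk_surjective a
  refine ⟨t, g, ?_⟩
  rw [eq_frac_iff, locMap_xprod, h]
  rfl

theorem res_frac (t : ℕ) {j : Fin (n + 1)} {J : Finset (Fin (n + 1))} (hj : j ∈ J)
    (g : MvPolynomial (Fin (n + 1)) k) :
    Cech.res (var f) (Finset.erase_subset j J) (frac f t (J.erase j) g) =
      frac f t J (g * X j ^ t) := by
  have h1 : ∀ a, Cech.res (var f) (Finset.erase_subset j J) (locMap f (J.erase j) a) =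
      locMap f J a := fun a => AlgHom.commutes _ _
  rw [eq_frac_iff, ← xprod_erase_mul hj, map_mul, mul_pow, ← h1 (xprod k _), ← map_pow,
    ← mul_assoc, ← map_mul, frac_mul, h1, map_mul, map_pow]

variable (f) in
/-- The Čech cochain with components `e_I / x_I ^ t`. -/
noncomputable def fracCochain (t : ℕ) (e : Finset (Fin (n + 1)) → MvPolynomial (Fin (n + 1)) k) :
    Cech.Cochain (var f) := fun I => frac f t I (e I)

theorem fracCochain_scale (t s : ℕ) (e : Finset (Fin (n + 1)) → MvPolynomial (Fin (n + 1)) k) :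
    fracCochain f (t + s) (fun I => xprod k I ^ s * e I) = fracCochain f t e :=
  funext fun I => frac_scale t s I (e I)

theorem fracCochain_sub (t : ℕ) (e e' : Finset (Fin (n + 1)) → MvPolynomial (Fin (n + 1)) k) :
    fracCochain f t (e - e') = fracCochain f t e - fracCochain f t e' :=
  funext fun I => frac_sub t I (e I) (e' I)

theorem d_fracCochain (t : ℕ) (e : Finset (Fin (n + 1)) → MvPolynomial (Fin (n + 1)) k) :
    Cech.d (var f) (fracCochain f t e) = fracCochain f t (numD t e) := by
  funext J
  change ∑ j ∈ J, Cech.sign j J • Cech.res (var f) (Finset.erase_subset j J)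
    (frac f t (J.erase j) (e (J.erase j))) = frac f t J _
  rw [numD_apply, frac_sum]
  refine Finset.sum_congr rfl fun j hj => ?_
  rw [res_frac t hj, frac_zsmul]

theorem frobCochain_fracCochain (p : ℕ) [Fact p.Prime] [CharP k p] (t : ℕ)
    (e : Finset (Fin (n + 1)) → MvPolynomial (Fin (n + 1)) k) :
    Cech.frobCochain k p (var f) (fracCochain f t e) =
      fracCochain f (p * t) (fun I => e I ^ p) :=
  funext fun I => (frac_pow p t I (e I)).symm

theorem exists_eq_fracCochain (c : Cech.Cochain (var f)) :
    ∃ t e, c = fracCochain f t e := by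
  choose t g h using fun I => exists_eq_frac (c I)
  refine ⟨∑ I, t I, fun I => xprod k I ^ (∑ J, t J - t I) * g I, funext fun I => ?_⟩
  obtain ⟨r, hr⟩ := Nat.exists_eq_add_of_le
    (Finset.single_le_sum (fun _ _ => Nat.zero_le _) (Finset.mem_univ I) : t I ≤ ∑ J, t J)
  change c I = frac f (∑ J, t J) I (xprod k I ^ (∑ J, t J - t I) * g I)
  rw [hr, Nat.add_sub_cancel_left, frac_scale, h I]

theorem fracCochain_eq_zero {t : ℕ} {e : Finset (Fin (n + 1)) → MvPolynomial (Fin (n + 1)) k}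
    (h : fracCochain f t e = 0) : ∃ s, ∀ I, f ∣ xprod k I ^ s * e I := by
  choose s hs using fun I => frac_eq_zero_iff.mp (congrFun h I)
  refine ⟨∑ I, s I, fun I => (hs I).trans (mul_dvd_mul_right (pow_dvd_pow _ ?_) _)⟩
  exact Finset.single_le_sum (fun _ _ => Nat.zero_le _) (Finset.mem_univ I)

end Hypersurface

/-! ### The connecting homomorphism H^n(R/fR) → H^{n+1}(R) and its injectivity. -/

namespace Hypersurface

open MvPolynomial

variable {k : Type u} [Field k] {n : ℕ} {f : MvPolynomial (Fin (n + 1)) k}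

theorem numD_mem_powIdeal (t : ℕ) (e : Finset (Fin (n + 1)) → MvPolynomial (Fin (n + 1)) k)
    (J : Finset (Fin (n + 1))) : numD t e J ∈ powIdeal k t Set.univ := by
  rw [numD_apply]
  refine Ideal.sum_mem _ fun j _ => zsmul_mem (Ideal.mul_mem_left _ _ ?_) _
  exact Ideal.subset_span ⟨j, Set.mem_univ j, rfl⟩

theorem xprod_univ_pow (s : ℕ) : xprod k (Finset.univ : Finset (Fin (n + 1))) ^ s =
    monomial (Finsupp.equivFunOnFinite.symm fun _ => s) 1 := by
  rw [xprod, ← Finset.prod_pow, monomial_eq, map_one, one_mul, Finsupp.prod_fintype]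
  · simp
  · simp

/-- The numerator of the image under the connecting homomorphism `H^n(R/fR) → H^{n+1}(R)` of a
coboundary lies in the ideal of the powers of the variables. -/
theorem mem_powIdeal_of_mem_coboundaries (hf0 : f ≠ 0) {t : ℕ}
    {e : Finset (Fin (n + 1)) → MvPolynomial (Fin (n + 1)) k} {h : MvPolynomial (Fin (n + 1)) k}
    (he : numD t e Finset.univ = f * h)
    (hc : fracCochain f t e ∈ Cech.coboundaries (var f) n) : h ∈ powIdeal k t Set.univ := by
  obtain ⟨b, -, hb⟩ := hc
  obtain ⟨s, β, rfl⟩ := exists_eq_fracCochain b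
  rw [d_fracCochain, ← fracCochain_scale s t, ← fracCochain_scale t s, add_comm s t,
    ← sub_eq_zero, ← fracCochain_sub] at hb
  obtain ⟨r, hr⟩ := fracCochain_eq_zero hb
  choose u hu using hr
  -- Over R the cochain e differs from a coboundary only by a multiple f u, after scaling. Applying
  -- the differential kills the coboundary, and cancelling f expresses a monomial multiple of h by
  -- powers of the variables.
  have h1 : numD (t + s + r) (fun I => xprod k I ^ r *
      ((fun I => xprod k I ^ t * numD s β I) - fun I => xprod k I ^ s * e I) I) =
      f • numD (t + s + r) u := by
    rw [← map_smul]
    congr 1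
    exact _root_.funext hu
  rw [numD_scale, map_sub, numD_scale, ← numD_scale s t, add_comm t s, numD_numD] at h1
  have h2 := congrFun h1 Finset.univ
  simp only [Pi.sub_apply, Pi.zero_apply, Pi.smul_apply, smul_eq_mul, zero_sub, he] at h2
  have h3 : xprod k Finset.univ ^ (r + s) * h = - numD (s + t + r) u Finset.univ := by
    refine mul_left_cancel₀ hf0 ?_
    rw [mul_neg, ← h2, pow_add]
    ring
  refine mem_powIdeal_univ_of_monomial_mul_mem (s := r + s)
    (c := Finsupp.equivFunOnFinite.symm fun _ => r + s) (fun _ => rfl) ?_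
  rw [← xprod_univ_pow, h3, show t + (r + s) = s + t + r by ring]
  exact neg_mem (numD_mem_powIdeal _ _ _)

theorem compl_card_eq {I : Finset (Fin (n + 1))} (hI : I.card = n) :
    ∃ i, I = Finset.univ.erase i := by
  have h1 : Iᶜ.card = 1 := by
    rw [Finset.card_compl, hI, Fintype.card_fin]
    omega
  obtain ⟨i, hi⟩ := Finset.card_eq_one.mp h1
  refine ⟨i, ?_⟩
  rw [← compl_compl I, hi]
  ext j
  simp

theorem numD_eq_zero_of_card {t m : ℕ} {e : Finset (Fin (n + 1)) → MvPolynomial (Fin (n + 1)) k}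
    (he : ∀ I, I.card + 1 ≠ m → e I = 0) {J : Finset (Fin (n + 1))} (hJ : J.card ≠ m) :
    numD t e J = 0 := by
  rw [numD_apply]
  refine Finset.sum_eq_zero fun j hj => ?_
  rw [he _ (by rwa [Finset.card_erase_add_one hj]), zero_mul, smul_zero]

/-- The numerators of the Čech complex of the polynomial ring are exact in degree `n`. -/
theorem exists_numD_eq {t : ℕ} {e : Finset (Fin (n + 1)) → MvPolynomial (Fin (n + 1)) k}
    (he : ∀ I, I.card ≠ n → e I = 0) (h0 : numD t e Finset.univ = 0) :
    ∃ b, (∀ I, I.card + 1 ≠ n → b I = 0) ∧ numD t b = e := by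
  -- Sets of size n are indexed by their missing element, so a cochain with zero top differential is
  -- a signed syzygy of the x_i^t. A Koszul relation between i and j is the differential of a
  -- cochain supported on the complement of {i, j}.
  have key : (fun i => Cech.sign i Finset.univ • e (Finset.univ.erase i)) ∈
      Submodule.span (MvPolynomial (Fin (n + 1)) k) {v | ∃ i j, i < j ∧
      v = (X j ^ t : MvPolynomial (Fin (n + 1)) k) •
          Pi.single i (1 : MvPolynomial (Fin (n + 1)) k) -
        (X i ^ t : MvPolynomial (Fin (n + 1)) k) •
          Pi.single j (1 : MvPolynomial (Fin (n + 1)) k)} := by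
    refine mem_span_koszul_of_sum_eq_zero t Finset.univ (by simp) ?_
    rw [← h0, numD_apply]
    exact Finset.sum_congr rfl fun j _ => smul_mul_assoc _ _ _
  obtain ⟨b, hb, hb'⟩ : ∃ b : Finset (Fin (n + 1)) → MvPolynomial (Fin (n + 1)) k,
      (∀ I, I.card + 1 ≠ n → b I = 0) ∧ ∀ i, Cech.sign i Finset.univ •
        numD t b (Finset.univ.erase i) = Cech.sign i Finset.univ • e (Finset.univ.erase i) := by
    refine Submodule.span_induction (p := fun g _ =>
      ∃ b : Finset (Fin (n + 1)) → MvPolynomial (Fin (n + 1)) k, (∀ I, I.card + 1 ≠ n → b I = 0) ∧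
      ∀ i, Cech.sign i Finset.univ • numD t b (Finset.univ.erase i) = g i) ?_ ?_ ?_ ?_ key
    · rintro _ ⟨i, j, hij, rfl⟩
      have hs1 := Cech.sign_erase_of_lt hij Finset.univ
      have hs2 := Cech.sign_erase_of_gt hij (Finset.mem_univ i)
      set A := Cech.sign i (Finset.univ : Finset (Fin (n + 1))) with hA
      set B := Cech.sign j (Finset.univ : Finset (Fin (n + 1))) with hB
      have hB2 : B * B = 1 := Cech.sign_mul_self _ _
      have hA2 : A * A = 1 := Cech.sign_mul_self _ _
      -- The factor -(A B) cancels the signs: it yields A(-B)(-AB) = 1 in position i and BA(-AB) =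
      -- -1 in position j.
      refine ⟨Pi.single ((Finset.univ.erase i).erase j) ((-(A * B)) • 1), ?_, fun l => ?_⟩
      · intro I hI
        rw [Pi.single_apply, if_neg]
        rintro rfl
        apply hI
        rw [Finset.card_erase_add_one (by simp [hij.ne']), Finset.card_erase_of_mem (by simp)]
        simp
      · rw [numD_apply]
        have hset : ∀ m ∈ Finset.univ.erase l, ((Finset.univ.erase l).erase m =
            (Finset.univ.erase i).erase j ↔ (l = i ∧ m = j) ∨ (l = j ∧ m = i)) := by
          intro m hm
          have hml : m ≠ l := (Finset.mem_erase.mp hm).1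
          constructor
          · intro h
            have h1 := Finset.ext_iff.mp h i
            have h2 := Finset.ext_iff.mp h j
            simp only [Finset.mem_erase, Finset.mem_univ, and_true, ne_eq, not_true_eq_false,
              and_false, false_and, iff_false, not_and, not_not] at h1 h2
            by_cases hl : l = i
            · left
              refine ⟨hl, ?_⟩
              by_contra hm'
              exact hij.ne (hl ▸ (h2 (fun h => hm' h.symm)).symm)
            · right
              have hm' : i = m := by
                by_contra h3
                exact hl (h1 h3).symm
              refine ⟨?_, hm'.symm⟩
              exact (h2 (fun h => hij.ne (hm'.trans h.symm))).symm
          · rintro (⟨rfl, rfl⟩ | ⟨rfl, rfl⟩)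
            · rfl
            · exact Finset.erase_right_comm
        have hterm : ∀ m ∈ Finset.univ.erase l, Cech.sign m (Finset.univ.erase l) •
            ((Pi.single ((Finset.univ.erase i).erase j) ((-(A * B)) • 1) :
              Finset (Fin (n + 1)) → MvPolynomial (Fin (n + 1)) k)
              ((Finset.univ.erase l).erase m) * X m ^ t) =
            if (l = i ∧ m = j) ∨ (l = j ∧ m = i) then
              Cech.sign m (Finset.univ.erase l) • (((-(A * B)) • 1) * X m ^ t) else 0 := by
          intro m hm
          rw [Pi.single_apply]
          simp only [hset m hm]
          split_ifs <;> simp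
        rw [Finset.sum_congr rfl hterm]
        by_cases hl : l = i
        · subst hl
          rw [Finset.sum_eq_single j]
          · rw [if_pos (Or.inl ⟨rfl, rfl⟩), hs2]
            simp only [Pi.sub_apply, Pi.smul_apply, Pi.single_eq_same, smul_eq_mul, mul_one,
              Pi.single_eq_of_ne hij.ne, mul_zero, sub_zero]
            rw [smul_mul_assoc, one_mul, smul_smul, smul_smul, ← hA,
              show A * -B * -(A * B) = A * A * (B * B) by ring, hA2, hB2, one_mul, one_smul]
          · intro m _ hm
            rw [if_neg]
            rintro (⟨-, h⟩ | ⟨h, -⟩)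
            · exact hm h
            · exact hij.ne h
          · intro h
            exact absurd (by simp [hij.ne']) h
        · by_cases hl' : l = j
          · subst hl'
            rw [Finset.sum_eq_single i]
            · rw [if_pos (Or.inr ⟨rfl, rfl⟩), hs1]
              simp only [Pi.sub_apply, Pi.smul_apply, Pi.single_eq_same, smul_eq_mul, mul_one,
                Pi.single_eq_of_ne hij.ne', mul_zero, zero_sub]
              rw [smul_mul_assoc, one_mul, smul_smul, smul_smul, ← hB,
                show B * A * -(A * B) = -(A * A * (B * B)) by ring, hA2, hB2, one_mul, neg_smul,
                one_smul]
            · intro m _ hm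
              rw [if_neg]
              rintro (⟨h, -⟩ | ⟨-, h⟩)
              · exact hl h
              · exact hm h
            · intro h
              exact absurd (by simp [hij.ne]) h
          · rw [Finset.sum_eq_zero]
            · simp [Pi.single_eq_of_ne hl, Pi.single_eq_of_ne hl']
            · intro m _
              rw [if_neg]
              rintro (⟨h, -⟩ | ⟨h, -⟩)
              · exact hl h
              · exact hl' h
    · exact ⟨0, fun _ _ => rfl, fun i => by simp⟩
    · rintro g g' _ _ ⟨b, hb, h⟩ ⟨b', hb', h'⟩
      refine ⟨b + b', fun I hI => by rw [Pi.add_apply, hb I hI, hb' I hI, add_zero], fun i => ?_⟩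
      rw [map_add, Pi.add_apply, smul_add, h, h', Pi.add_apply]
    · rintro a g _ ⟨b, hb, h⟩
      refine ⟨a • b, fun I hI => by rw [Pi.smul_apply, hb I hI, smul_zero], fun i => ?_⟩
      rw [map_smul, Pi.smul_apply, smul_comm, h, Pi.smul_apply]
  refine ⟨b, hb, _root_.funext fun I => ?_⟩
  by_cases hI : I.card = n
  · obtain ⟨i, rfl⟩ := compl_card_eq hI
    have := congrArg (Cech.sign i (Finset.univ : Finset (Fin (n + 1))) • ·) (hb' i)
    simpa only [smul_smul, Cech.sign_mul_self, one_smul] using this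
  · rw [he I hI, numD_eq_zero_of_card hb hI]

theorem exists_numD_univ_eq (t : ℕ) (a : Fin (n + 1) → MvPolynomial (Fin (n + 1)) k) :
    ∃ w : Finset (Fin (n + 1)) → MvPolynomial (Fin (n + 1)) k,
      (∀ I, I.card ≠ n → w I = 0) ∧
      (∀ i, w (Finset.univ.erase i) = Cech.sign i Finset.univ • a i) ∧
      numD t w Finset.univ = ∑ i, a i * X i ^ t := by
  have hw : ∀ i : Fin (n + 1), (if (Finset.univ.erase i).card = n then
      ∑ j ∈ (Finset.univ.erase i)ᶜ, Cech.sign j Finset.univ • a j else 0) =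
      Cech.sign i Finset.univ • a i := by
    intro i
    have h1 : (Finset.univ.erase i)ᶜ = {i} := by
      ext j
      simp
    rw [if_pos (by simp), h1, Finset.sum_singleton]
  -- For |I| = n the complement is a singleton, so the sum reads off the missing index.
  refine ⟨fun I => if I.card = n then ∑ j ∈ Iᶜ, Cech.sign j Finset.univ • a j else 0,
    fun I hI => if_neg hI, hw, ?_⟩
  rw [numD_apply]
  refine Finset.sum_congr rfl fun i _ => ?_
  rw [hw, smul_mul_assoc, smul_smul, Cech.sign_mul_self, one_smul]

theorem exists_sum_mul_X_pow {t : ℕ} {h : MvPolynomial (Fin (n + 1)) k}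
    (hh : h ∈ powIdeal k t Set.univ) : ∃ a : Fin (n + 1) → MvPolynomial (Fin (n + 1)) k,
      ∑ i, a i * X i ^ t = h := by
  rw [powIdeal, Set.image_univ] at hh
  exact Ideal.mem_span_range_iff_exists_fun.mp hh

/-- A cocycle whose image under the connecting homomorphism `H^n(R/fR) → H^{n+1}(R)` vanishes is
a coboundary. -/
theorem mem_coboundaries_of_mem_powIdeal {t : ℕ}
    {e : Finset (Fin (n + 1)) → MvPolynomial (Fin (n + 1)) k} {h : MvPolynomial (Fin (n + 1)) k}
    (he : ∀ I, I.card ≠ n → e I = 0) (heh : numD t e Finset.univ = f * h)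
    (hh : h ∈ powIdeal k t Set.univ) : fracCochain f t e ∈ Cech.coboundaries (var f) n := by
  obtain ⟨a, rfl⟩ := exists_sum_mul_X_pow hh
  -- Writing h as the top differential of w makes e - f w a cocycle over R. It is a coboundary
  -- there, and f w disappears modulo f.
  obtain ⟨w, hw, -, hwa⟩ := exists_numD_univ_eq t a
  obtain ⟨b, hb, hb'⟩ := exists_numD_eq (t := t) (e := e - f • w)
    (fun I hI => by rw [Pi.sub_apply, Pi.smul_apply, he I hI, hw I hI, smul_zero, sub_zero])
    (by rw [map_sub, map_smul, Pi.sub_apply, Pi.smul_apply, heh, hwa, smul_eq_mul, sub_self])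
  refine ⟨fracCochain f t b, fun I hI => ?_, ?_⟩
  · change frac f t I (b I) = 0
    rw [hb I hI, frac_zero]
  · rw [d_fracCochain, hb', fracCochain_sub, sub_eq_self]
    exact _root_.funext fun I => frac_mul_self t I (w I)

theorem fracCochain_mem_cocycles {t : ℕ}
    {e : Finset (Fin (n + 1)) → MvPolynomial (Fin (n + 1)) k} {h : MvPolynomial (Fin (n + 1)) k}
    (he : ∀ I, I.card ≠ n → e I = 0) (heh : numD t e Finset.univ = f * h) :
    fracCochain f t e ∈ Cech.cocycles (var f) n := by
  refine ⟨fun I hI => ?_, ?_⟩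
  · change frac f t I (e I) = 0
    rw [he I hI, frac_zero]
  · rw [d_fracCochain]
    funext J
    change frac f t J (numD t e J) = 0
    by_cases hJ : J.card = n + 1
    · have : J = Finset.univ := by
        rw [← Finset.card_eq_iff_eq_univ, hJ, Fintype.card_fin]
      rw [this, heh, frac_mul_self]
    · rw [numD_eq_zero_of_card (fun I hI => he I fun h => hI (by rw [h])) hJ, frac_zero]

theorem mk_eq_zero_iff (c : Cech.cocycles (var f) n) :
    (Submodule.Quotient.mk c : H f n) = 0 ↔ c.1 ∈ Cech.coboundaries (var f) n :=
  Submodule.Quotient.mk_eq_zero _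

/-- Homogeneity of the coefficients in the ideal of the powers of the variables. -/
theorem exists_sum_mul_X_pow_of_isHomogeneous {t M : ℕ} {h : MvPolynomial (Fin (n + 1)) k}
    (hh : h ∈ powIdeal k t Set.univ) (hM : h.IsHomogeneous M) (ht : t ≤ M) :
    ∃ a : Fin (n + 1) → MvPolynomial (Fin (n + 1)) k,
      (∀ i, (a i).IsHomogeneous (M - t)) ∧ ∑ i, a i * X i ^ t = h := by
  obtain ⟨a, ha⟩ := exists_sum_mul_X_pow hh
  refine ⟨fun i => homogeneousComponent (M - t) (a i),
    fun i => homogeneousComponent_isHomogeneous _ _, ?_⟩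
  have h2 : homogeneousComponent M h = h := by rw [homogeneousComponent_of_mem hM, if_pos rfl]
  conv_rhs => rw [← h2, ← ha, map_sum]
  refine Finset.sum_congr rfl fun i _ => ?_
  have h3 : ((X i : MvPolynomial (Fin (n + 1)) k) ^ t).IsHomogeneous t := by
    simpa using (isHomogeneous_X k i).pow t
  rw [mul_comm (a i), homogeneousComponent_mul_of_isHomogeneous h3 ht, mul_comm]

end Hypersurface

/-! ### Macaulay duality and Frobenius on the top local cohomology of R. -/

namespace MvPolynomial

variable {k : Type u} [Field k] {σ : Type*}

theorem homogeneousComponent_mem_span {S : Set (MvPolynomial σ k)}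
    (hS : ∀ g ∈ S, ∃ m, g.IsHomogeneous m) {g : MvPolynomial σ k} (hg : g ∈ Ideal.span S) (i : ℕ) :
    homogeneousComponent i g ∈ Ideal.span S := by
  let _ : GradedAlgebra (homogeneousSubmodule σ k) := gradedAlgebra
  have h : (Ideal.span S).IsHomogeneous (homogeneousSubmodule σ k) :=
    Ideal.homogeneous_span _ _ fun g hg => hS g hg
  rw [← decomposition.decompose'_apply]
  exact h i hg

/-- Macaulay's inverse system: if a form of degree `i` does not lie in the homogeneous ideal `J`,
then some form `h` that is not in `(x_l ^ (i + 1))` is multiplied by `J` into that ideal. -/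
theorem exists_socle_form [Fintype σ] {S : Set (MvPolynomial σ k)}
    (hS : ∀ g ∈ S, ∃ m, g.IsHomogeneous m) {a : σ →₀ ℕ}
    (ha : monomial a 1 ∉ Ideal.span S) :
    ∃ (M : ℕ) (h : MvPolynomial σ k), M + a.degree = Fintype.card σ * a.degree ∧
      h.IsHomogeneous M ∧ h ∉ powIdeal k (a.degree + 1) Set.univ ∧
      ∀ g ∈ Ideal.span S, g * h ∈ powIdeal k (a.degree + 1) Set.univ := by
  classical
  set i := a.degree with hi
  -- A linear functional that vanishes on J but not at x^a; its restriction to degree i is turned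
  -- into the form h.
  obtain ⟨L, hLa, hL⟩ := Submodule.exists_dual_map_eq_bot_of_notMem
    (p := (Ideal.span S).restrictScalars k) ha inferInstance
  have hL0 : ∀ g ∈ Ideal.span S, L g = 0 := fun g hg => by
    have := Submodule.mem_map_of_mem (f := L) (p := (Ideal.span S).restrictScalars k) hg
    rwa [hL, Submodule.mem_bot] at this
  let T : Finset (σ →₀ ℕ) := Finset.univ.finsuppAntidiag i
  have hT : ∀ b, b ∈ T ↔ b.degree = i := fun b => by
    simp [T, Finsupp.degree_eq_sum]
  -- x^τ is the largest monomial outside (x_l^(i+1)), and every monomial of degree i divides it.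
  -- Thus b ↦ τ - b gives the perfect pairing of monomials behind the duality.
  let τ : σ →₀ ℕ := Finsupp.equivFunOnFinite.symm fun _ => i
  have hτ : ∀ l, τ l = i := fun l => rfl
  have hTτ : ∀ b ∈ T, b ≤ τ := fun b hb l => by
    rw [hτ, ← (hT b).mp hb]
    exact Finsupp.le_degree l b
  have hτdeg : τ.degree = Fintype.card σ * i := by
    rw [Finsupp.degree_eq_sum]
    simp [hτ]
  have haT : a ∈ T := (hT a).mpr rfl
  have hsub : ∀ b ∈ T, (τ - b).degree + i = Fintype.card σ * i := fun b hb => by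
    rw [← hτdeg, ← (hT b).mp hb, ← map_add, tsub_add_cancel_of_le (hTτ b hb)]
  let h : MvPolynomial σ k := ∑ b ∈ T, monomial (τ - b) (L (monomial b 1))
  -- The coefficients of g h outside (x_l^(i+1)) are values of L on degree-i components of multiples
  -- of g, so they vanish for g ∈ J.
  have hcoef : ∀ (g : MvPolynomial σ k) (c : σ →₀ ℕ), c ≤ τ → coeff c (g * h) =
      L (homogeneousComponent i (monomial (τ - c) 1 * g)) := by
    intro g c hc
    have h1 : homogeneousComponent i (monomial (τ - c) 1 * g) =
        ∑ b ∈ T, coeff b (monomial (τ - c) 1 * g) • monomial b 1 := by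
      ext b
      rw [coeff_homogeneousComponent, coeff_sum]
      simp only [coeff_smul, coeff_monomial, smul_eq_mul, mul_ite, mul_one, mul_zero]
      rw [Finset.sum_ite_eq']
      simp only [hT]
    rw [h1, map_sum, Finset.mul_sum, coeff_sum]
    refine Finset.sum_congr rfl fun b hb => ?_
    rw [map_smul, coeff_mul_monomial', coeff_monomial_mul', smul_eq_mul, one_mul]
    have hbτ := hTτ b hb
    by_cases hle : τ - b ≤ c
    · have hle' : τ - c ≤ b := by
        intro l
        have h1 := hle l
        have h2 := hc l
        have h3 := hbτ l
        simp only [Finsupp.tsub_apply] at h1 ⊢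
        omega
      rw [if_pos hle, if_pos hle']
      have : c - (τ - b) = b - (τ - c) := by
        ext l
        have h1 := hle l
        have h2 := hc l
        have h3 := hbτ l
        simp only [Finsupp.tsub_apply] at h1 ⊢
        omega
      rw [this]
    · rw [if_neg hle, if_neg, zero_mul]
      contrapose! hle
      intro l
      have h1 := hle l
      have h2 := hc l
      have h3 := hbτ l
      simp only [Finsupp.tsub_apply] at h1 ⊢
      omega
  refine ⟨(τ - a).degree, h, hsub a haT, ?_, ?_, ?_⟩
  · refine IsHomogeneous.sum _ _ _ fun b hb => isHomogeneous_monomial _ ?_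
    have h1 := hsub a haT
    have h2 := hsub b hb
    omega
  · intro hmem
    rw [mem_powIdeal_iff] at hmem
    obtain ⟨l, -, hl⟩ := hmem (τ - a) (by
      rw [mem_support_iff, ← one_mul h, hcoef 1 _ tsub_le_self, mul_one,
        tsub_tsub_cancel_of_le (hTτ a haT)]
      rwa [homogeneousComponent_of_mem (isHomogeneous_monomial (1 : k) rfl), if_pos rfl])
    rw [Finsupp.tsub_apply, hτ] at hl
    omega
  · intro g hg
    rw [mem_powIdeal_iff]
    intro c hc
    by_contra! hlt
    have hcτ : c ≤ τ := fun l => Nat.lt_succ_iff.mp (hlt l (Set.mem_univ l))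
    rw [mem_support_iff, hcoef g c hcτ] at hc
    exact hc (hL0 _ (homogeneousComponent_mem_span hS (Ideal.mul_mem_left _ _ hg) i))

variable {p : ℕ} [Fact p.Prime] [CharP k p] {ι : Type*} [Fintype ι]
    {φ : ι → MvPolynomial σ k →+ MvPolynomial σ k} {e : ι → MvPolynomial σ k}

/-- (x_l^(pt)) is the Frobenius power of (x_l^t), and φ_i(g h^p) = φ_i(g) h. -/
theorem mul_pow_mem_powIdeal_iff (hφ : ∀ i, IsCartierLinear p (φ i))
    (he : ∀ g, g = ∑ i, φ i g ^ p * e i) {t : ℕ} {g h : MvPolynomial σ k} :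
    g * h ^ p ∈ powIdeal k (p * t) Set.univ ↔ ∀ i, φ i g * h ∈ powIdeal k t Set.univ := by
  have h1 : powIdeal k (p * t) (Set.univ : Set σ) =
      (powIdeal k t Set.univ).map (frobeniusOver k p (MvPolynomial σ k)) := by
    rw [powIdeal, powIdeal, Ideal.map_span, Set.image_image]
    congr 2
    funext i
    change _ = (X i ^ t) ^ p
    rw [← pow_mul, mul_comm]
  rw [h1, mem_map_frobeniusOver_iff hφ he]
  refine forall_congr' fun i => ?_
  rw [mul_comm g, hφ, mul_comm h]

end MvPolynomial

/-! ### Degree bounds on representatives; from large degrees of J to injectivity. -/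

namespace Hypersurface

open MvPolynomial

variable {k : Type u} [Field k] {n : ℕ}

/-- All monomials of `g` have degree at most `M`; only `g = 0` if `M` is negative. -/
def DegLE (M : ℤ) (g : MvPolynomial (Fin (n + 1)) k) : Prop := g ≠ 0 → (g.totalDegree : ℤ) ≤ M

theorem DegLE.zero (M : ℤ) : DegLE M (0 : MvPolynomial (Fin (n + 1)) k) := fun h => absurd rfl h

theorem DegLE.add {M : ℤ} {g h : MvPolynomial (Fin (n + 1)) k} (hg : DegLE M g) (hh : DegLE M h) :
    DegLE M (g + h) := by
  intro h0
  by_cases hg0 : g = 0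
  · rw [hg0, zero_add] at h0 ⊢
    exact hh h0
  by_cases hh0 : h = 0
  · rw [hh0, add_zero] at h0 ⊢
    exact hg h0
  have h1 := totalDegree_add g h
  have h2 := hg hg0
  have h3 := hh hh0
  omega

theorem DegLE.mul {M : ℤ} {s : ℕ} {c g : MvPolynomial (Fin (n + 1)) k} (hg : DegLE M g)
    (hc : c.totalDegree ≤ s) : DegLE (M + s) (c * g) := by
  intro h0
  have h1 := totalDegree_mul c g
  have h2 := hg (right_ne_zero_of_mul h0)
  omega

theorem DegLE.zsmul {M : ℤ} {g : MvPolynomial (Fin (n + 1)) k} (hg : DegLE M g) (c : ℤ) :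
    DegLE M (c • g) := by
  intro h0
  have h1 : g ≠ 0 := fun h => h0 (by rw [h, smul_zero])
  have h2 := hg h1
  have h3 := totalDegree_smul_le c g
  omega

theorem DegLE.sum {ι : Type*} {s : Finset ι} {M : ℤ} {g : ι → MvPolynomial (Fin (n + 1)) k}
    (hg : ∀ i ∈ s, DegLE M (g i)) : DegLE M (∑ i ∈ s, g i) := by
  classical
  induction s using Finset.induction_on with
  | empty => exact DegLE.zero M
  | insert i s hi ih =>
    rw [Finset.sum_insert hi]
    exact (hg i (Finset.mem_insert_self i s)).add
      (ih fun j hj => hg j (Finset.mem_insert_of_mem hj))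

theorem totalDegree_xprod_pow (I : Finset (Fin (n + 1))) (s : ℕ) :
    (xprod k I ^ s).totalDegree ≤ s * I.card := by
  refine (totalDegree_pow _ _).trans (Nat.mul_le_mul_left s ?_)
  refine (totalDegree_finsetProd _ _).trans ?_
  simp

theorem DegLE.scale {N : ℤ} {t : ℕ} {I : Finset (Fin (n + 1))} {g : MvPolynomial (Fin (n + 1)) k}
    (hg : DegLE (N + t * I.card) g) (s : ℕ) :
    DegLE (N + (t + s : ℕ) * I.card) (xprod k I ^ s * g) := by
  convert hg.mul (totalDegree_xprod_pow I s) using 1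
  push_cast
  ring

theorem DegLE.numD {N : ℤ} {t : ℕ} {e : Finset (Fin (n + 1)) → MvPolynomial (Fin (n + 1)) k}
    (he : ∀ I, DegLE (N + t * I.card) (e I)) (J : Finset (Fin (n + 1))) :
    DegLE (N + t * J.card) (numD t e J) := by
  rw [numD_apply]
  refine DegLE.sum fun j hj => DegLE.zsmul ?_ _
  rw [mul_comm (e _)]
  have h1 := (he (J.erase j)).mul (totalDegree_X_pow (R := k) j t).le
  convert h1 using 1
  have h2 := Finset.card_erase_add_one hj
  rw [← h2]
  push_cast
  ring

theorem DegLE.of_mul {M : ℤ} {d : ℕ} {f h : MvPolynomial (Fin (n + 1)) k} (hf0 : f ≠ 0)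
    (hf : f.IsHomogeneous d) (hfh : DegLE M (f * h)) : DegLE (M - d) h := by
  intro h0
  have h1 := hfh (mul_ne_zero hf0 h0)
  rw [totalDegree_mul_of_isDomain hf0 h0, hf.totalDegree hf0] at h1
  push_cast at h1
  omega

theorem degLE_of_isWeightedHomogeneous {M M' : ℤ} {g : MvPolynomial (Fin (n + 1)) k}
    (hg : IsWeightedHomogeneous (fun _ => (1 : ℤ)) g M) (hM : M ≤ M') : DegLE M' g := by
  intro h0
  have h1 : ∀ b ∈ g.support, ((b.sum fun _ e => e : ℕ) : ℤ) = M := by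
    intro b hb
    rw [← hg (mem_support_iff.mp hb), Finsupp.weight_apply, Finsupp.sum, Finsupp.sum]
    push_cast
    exact Finset.sum_congr rfl fun i _ => by simp
  obtain ⟨b, hb⟩ := support_nonempty.mpr h0
  obtain ⟨M0, rfl⟩ : ∃ M0 : ℕ, M = M0 := ⟨_, (h1 b hb).symm⟩
  refine le_trans ?_ hM
  have : g.totalDegree ≤ M0 := Finset.sup_le fun b hb => by
    have := h1 b hb
    exact_mod_cast this.le
  exact_mod_cast this

variable {f : MvPolynomial (Fin (n + 1)) k}

/-- Classes of degree at most `N` are represented by cochains of fractions with numerators of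
bounded degree. -/
theorem exists_rep_of_mem_HLE {N : ℤ} {z : H f n} (hz : z ∈ HLE f n N) :
    ∃ (t : ℕ) (e : Finset (Fin (n + 1)) → MvPolynomial (Fin (n + 1)) k),
      (∀ I, I.card ≠ n → e I = 0) ∧ (∀ I, DegLE (N + t * I.card) (e I)) ∧
      ∃ h : fracCochain f t e ∈ Cech.cocycles (var f) n, z = Submodule.Quotient.mk ⟨_, h⟩ := by
  refine Submodule.iSup_induction _ (motive := fun z =>
    ∃ (t : ℕ) (e : Finset (Fin (n + 1)) → MvPolynomial (Fin (n + 1)) k),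
      (∀ I, I.card ≠ n → e I = 0) ∧ (∀ I, DegLE (N + t * I.card) (e I)) ∧
      ∃ h : fracCochain f t e ∈ Cech.cocycles (var f) n, z = Submodule.Quotient.mk ⟨_, h⟩) hz
    ?_ ?_ ?_
  · rintro ⟨j, hj : j ≤ N⟩ _ ⟨c, hc, rfl⟩
    have hc' : ∀ I, ∃ (t : ℕ) (g : MvPolynomial (Fin (n + 1)) k),
        IsWeightedHomogeneous (fun _ => (1 : ℤ)) g (j + t * I.card) ∧ c.1 I = frac f t I g := by
      intro I
      obtain ⟨t, g, hg, h⟩ := hc I (Set.mem_univ I)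
      refine ⟨t, g, hg, ?_⟩
      rw [eq_frac_iff, locMap_xprod]
      exact h
    choose t g hg hcg using hc'
    have hle : ∀ I, t I ≤ ∑ J, t J := fun I =>
      Finset.single_le_sum (fun _ _ => Nat.zero_le _) (Finset.mem_univ I)
    -- Off size n the components of the cocycle vanish only as fractions; their numerators are reset
    -- to 0.
    let e : Finset (Fin (n + 1)) → MvPolynomial (Fin (n + 1)) k := fun I =>
      if I.card = n then xprod k I ^ (∑ J, t J - t I) * g I else 0
    have he : c.1 = fracCochain f (∑ J, t J) e := by
      funext I
      change c.1 I = frac f (∑ J, t J) I (e I)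
      by_cases hI : I.card = n
      · obtain ⟨r, hr⟩ := Nat.exists_eq_add_of_le (hle I)
        simp only [e, if_pos hI]
        rw [hr, Nat.add_sub_cancel_left, frac_scale, hcg I]
      · simp only [e, if_neg hI, frac_zero]
        exact c.2.1 I hI
    refine ⟨∑ J, t J, e, fun I hI => if_neg hI, fun I => ?_, he ▸ c.2, ?_⟩
    · by_cases hI : I.card = n
      · obtain ⟨r, hr⟩ := Nat.exists_eq_add_of_le (hle I)
        simp only [e, if_pos hI]
        rw [hr, Nat.add_sub_cancel_left]
        exact (degLE_of_isWeightedHomogeneous (hg I) (by omega)).scale r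
      · simp only [e, if_neg hI]
        exact DegLE.zero _
    · exact congrArg Submodule.Quotient.mk (Subtype.ext he)
  · have h0 : fracCochain f 0 0 = 0 := funext fun I => frac_zero 0 I
    refine ⟨0, 0, fun _ _ => rfl, fun I => DegLE.zero _, h0 ▸ Submodule.zero_mem _, ?_⟩
    symm
    rw [mk_eq_zero_iff]
    change fracCochain f 0 0 ∈ _
    rw [h0]
    exact Submodule.zero_mem _
  · rintro _ _ ⟨t, e, he, hd, h, rfl⟩ ⟨t', e', he', hd', h', rfl⟩
    have hadd : fracCochain f (t + t') (fun I => xprod k I ^ t' * e I + xprod k I ^ t * e' I) =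
        fracCochain f t e + fracCochain f t' e' := by
      rw [← fracCochain_scale t t' e, ← fracCochain_scale t' t e', add_comm t' t]
      exact funext fun I => frac_add _ _ _ _
    refine ⟨t + t', _, fun I hI => ?_, fun I => ?_, hadd ▸ Submodule.add_mem _ h h', ?_⟩
    · rw [he I hI, he' I hI, mul_zero, mul_zero, add_zero]
    · refine ((hd I).scale t').add ?_
      rw [add_comm t t']
      exact (hd' I).scale t
    · rw [← Submodule.Quotient.mk_add]
      exact congrArg Submodule.Quotient.mk (Subtype.ext hadd.symm)

/-- The numerator of the image of a cocycle under the connecting homomorphism. -/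
theorem exists_numD_eq_mul {N : ℤ} {t : ℕ} {e : Finset (Fin (n + 1)) → MvPolynomial (Fin (n + 1)) k}
    (he : ∀ I, I.card ≠ n → e I = 0) (hd : ∀ I, DegLE (N + t * I.card) (e I))
    (hc : fracCochain f t e ∈ Cech.cocycles (var f) n) :
    ∃ (s : ℕ) (e' : Finset (Fin (n + 1)) → MvPolynomial (Fin (n + 1)) k)
      (h : MvPolynomial (Fin (n + 1)) k),
      (∀ I, I.card ≠ n → e' I = 0) ∧ (∀ I, DegLE (N + s * I.card) (e' I)) ∧
      fracCochain f t e = fracCochain f s e' ∧ numD s e' Finset.univ = f * h := by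
  have h1 := hc.2
  rw [d_fracCochain] at h1
  obtain ⟨s, hs⟩ := fracCochain_eq_zero h1
  obtain ⟨h, hh⟩ := hs Finset.univ
  -- The cocycle condition gives divisibility by f only after multiplication by x_I^s; absorbing
  -- this factor into the denominators makes it exact.
  refine ⟨t + s, fun I => xprod k I ^ s * e I, h, fun I hI => ?_, fun I => (hd I).scale s,
    (fracCochain_scale t s e).symm, ?_⟩
  · dsimp only
    rw [he I hI, mul_zero]
  · rw [numD_scale, ← hh]

section Frobenius

variable {p : ℕ} [Fact p.Prime] [CharP k p] {ι : Type*} [Fintype ι]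
    {φ : ι → MvPolynomial (Fin (n + 1)) k →+ MvPolynomial (Fin (n + 1)) k}
    {c : ι → MvPolynomial (Fin (n + 1)) k}

/-- The kernel of Frobenius on `H^n(R/fR)` in terms of the image under the connecting
homomorphism. -/
theorem frobH_mk_eq_zero_iff (hφ : ∀ i, IsCartierLinear p (φ i))
    (hc : ∀ g, g = ∑ i, φ i g ^ p * c i) (hf0 : f ≠ 0) {t : ℕ}
    {e : Finset (Fin (n + 1)) → MvPolynomial (Fin (n + 1)) k} {h : MvPolynomial (Fin (n + 1)) k}
    (he : ∀ I, I.card ≠ n → e I = 0) (heh : numD t e Finset.univ = f * h)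
    (hcoc : fracCochain f t e ∈ Cech.cocycles (var f) n) :
    Cech.frobH k p (var f) n (Submodule.Quotient.mk ⟨_, hcoc⟩) = 0 ↔
      ∀ i, φ i (f ^ (p - 1)) * h ∈ powIdeal k t Set.univ := by
  have hp : p.Prime := Fact.out
  -- From (f h)^p = f · f^(p-1) h^p: under the connecting homomorphism F becomes f^(p-1)F.
  have h1 : numD (p * t) (fun I => e I ^ p) Finset.univ = f * (f ^ (p - 1) * h ^ p) := by
    rw [numD_pow, heh, mul_pow, ← mul_assoc, mul_pow_sub_one hp.ne_zero]
  have h2 : ∀ I : Finset (Fin (n + 1)), I.card ≠ n → e I ^ p = 0 := fun I hI => by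
    rw [he I hI, zero_pow hp.ne_zero]
  rw [← mul_pow_mem_powIdeal_iff hφ hc]
  change (Submodule.Quotient.mk (Cech.frobCocycles k p (var f) n ⟨_, hcoc⟩) : H f n) = 0 ↔ _
  rw [mk_eq_zero_iff]
  change Cech.frobCochain k p (var f) (fracCochain f t e) ∈ _ ↔ _
  rw [frobCochain_fracCochain]
  exact ⟨mem_powIdeal_of_mem_coboundaries hf0 h1, mem_coboundaries_of_mem_powIdeal h2 h1⟩

/-- If all monomials of large degree lie in the ideal of the Cartier operators, then Frobenius
is injective in low degrees. -/
theorem injective_frobeniusLE (hφ : ∀ i, IsCartierLinear p (φ i))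
    (hc : ∀ g, g = ∑ i, φ i g ^ p * c i) (hf0 : f ≠ 0) {d : ℕ} (hf : f.IsHomogeneous d) {N : ℤ}
    (hJ : ∀ a : Fin (n + 1) →₀ ℕ, d - N - (n + 1) ≤ a.degree →
      monomial a 1 ∈ Ideal.span (Set.range fun i => φ i (f ^ (p - 1)))) :
    Function.Injective (frobeniusLE f p n N) := by
  rw [injective_iff_map_eq_zero]
  rintro ⟨z, hz⟩ hFz
  replace hFz : Cech.frobH k p (var f) n z = 0 := congrArg Subtype.val hFz
  refine Subtype.ext ?_
  change z = 0
  obtain ⟨t, e, he, hd, hcoc, rfl⟩ := exists_rep_of_mem_HLE hz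
  obtain ⟨s, e', h, he', hd', hee', heh⟩ := exists_numD_eq_mul he hd hcoc
  have hcoc' := hcoc
  rw [hee'] at hcoc'
  have hmk : (Submodule.Quotient.mk ⟨_, hcoc⟩ : H f n) = Submodule.Quotient.mk ⟨_, hcoc'⟩ :=
    congrArg Submodule.Quotient.mk (Subtype.ext hee')
  rw [hmk] at hFz ⊢
  rw [frobH_mk_eq_zero_iff hφ hc hf0 he' heh] at hFz
  rw [mk_eq_zero_iff]
  refine mem_coboundaries_of_mem_powIdeal he' heh ?_
  have hdeg : DegLE (N + s * (n + 1) - d) h := by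
    have := (DegLE.numD hd' Finset.univ)
    rw [heh, Finset.card_univ, Fintype.card_fin] at this
    exact_mod_cast this.of_mul hf0 hf
  have hJh : ∀ g ∈ Ideal.span (Set.range fun i => φ i (f ^ (p - 1))),
      g * h ∈ powIdeal k s Set.univ := by
    intro g hg
    refine Submodule.span_induction (p := fun g _ => g * h ∈ powIdeal k s Set.univ)
      ?_ ?_ ?_ ?_ hg
    · rintro _ ⟨i, rfl⟩
      exact hFz i
    · rw [zero_mul]
      exact Ideal.zero_mem _
    · intro x y _ _ hx hy
      rw [add_mul]
      exact Ideal.add_mem _ hx hy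
    · intro a x _ hx
      rw [smul_eq_mul, mul_assoc]
      exact Ideal.mul_mem_left _ _ hx
  rw [mem_powIdeal_iff]
  intro b hb
  by_contra! hlt
  replace hlt : ∀ i, b i < s := fun i => hlt i (Set.mem_univ i)
  -- If a monomial x^b of h avoids (x_i^s), then deg h ≤ N + s(n+1) - d gives |τ - b| ≥ d - N -
  -- (n+1). So x^(τ-b) ∈ J kills h, yet x^(τ-b) h contains x^τ, which is not in (x_i^s).
  let τ : Fin (n + 1) →₀ ℕ := Finsupp.equivFunOnFinite.symm fun _ => s - 1
  have hτ : ∀ i, τ i = s - 1 := fun i => rfl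
  have hbτ : b ≤ τ := fun i => by
    have := hlt i
    rw [hτ]
    omega
  have hτdeg : τ.degree = (n + 1) * (s - 1) := by
    rw [Finsupp.degree_eq_sum]
    simp [hτ]
  have hs1 : 1 ≤ s := by
    have := hlt 0
    omega
  have hsum : ((τ - b).degree : ℤ) + b.degree = (n + 1) * (s - 1) := by
    have h1 : (τ - b).degree + b.degree = (n + 1) * (s - 1) := by
      rw [← hτdeg, ← map_add, tsub_add_cancel_of_le hbτ]
    have h2 := congrArg (Nat.cast (R := ℤ)) h1
    push_cast [Nat.cast_sub hs1] at h2
    exact h2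
  have hb2 : (b.degree : ℤ) ≤ N + s * (n + 1) - d := by
    have h1 := hdeg (support_nonempty.mp ⟨b, hb⟩)
    have h2 : b.degree ≤ h.totalDegree := by
      rw [Finsupp.degree_apply]
      exact le_totalDegree hb
    omega
  have hmem := hJh _ (hJ (τ - b) (by nlinarith))
  rw [mem_powIdeal_iff] at hmem
  obtain ⟨i, -, hi⟩ := hmem τ (by
    have h1 := coeff_monomial_mul b (τ - b) 1 h
    rw [tsub_add_cancel_of_le hbτ, one_mul] at h1
    rw [mem_support_iff, h1]
    exact mem_support_iff.mp hb)
  rw [hτ] at hi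
  omega

end Frobenius

end Hypersurface

/-! ### From injectivity to large degrees of J. -/

namespace Hypersurface

open MvPolynomial

variable {k : Type u} [Field k] {n : ℕ} {f : MvPolynomial (Fin (n + 1)) k}
  {p : ℕ} [Fact p.Prime] [CharP k p] {ι : Type*} [Fintype ι]
    {φ : ι → MvPolynomial (Fin (n + 1)) k →+ MvPolynomial (Fin (n + 1)) k}
    {c : ι → MvPolynomial (Fin (n + 1)) k}

set_option maxHeartbeats 1000000 in
/-- If Frobenius is injective in low degrees, then all monomials of the corresponding degree lie
in the ideal of the Cartier operators. -/
theorem monomial_mem_of_injective_frobeniusLE (hφ : ∀ i, IsCartierLinear p (φ i))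
    (hc : ∀ g, g = ∑ i, φ i g ^ p * c i) (hf0 : f ≠ 0) {d : ℕ} (hf : f.IsHomogeneous d) {N : ℤ}
    (hS : ∀ i, ∃ m, (φ i (f ^ (p - 1))).IsHomogeneous m)
    (hinj : Function.Injective (frobeniusLE f p n N)) {a : Fin (n + 1) →₀ ℕ}
    (ha : d - N - (n + 1) ≤ a.degree) (had : a.degree + 1 ≤ d + n * a.degree) :
    monomial a 1 ∈ Ideal.span (Set.range fun i => φ i (f ^ (p - 1))) := by
  by_contra hnot
  obtain ⟨M, h, hM, hh, hh1, hh2⟩ := exists_socle_form (by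
    rintro _ ⟨i, rfl⟩
    exact hS i) hnot
  set i := a.degree with hi
  rw [Fintype.card_fin] at hM
  -- f ∈ J, so h is killed by f in H^{n+1}(R) and comes from a class in H^n(R/fR).
  have hfh : f * h ∈ powIdeal k (i + 1) Set.univ := hh2 f (mem_span_range_cartier hφ hc)
  have hMi : M = n * i := by
    rw [add_mul, one_mul] at hM
    omega
  -- `had` is exactly d + M ≥ i + 1, so the degree d + M - (i + 1) of the coefficients is not
  -- truncated.
  obtain ⟨b, hb, hbsum⟩ := exists_sum_mul_X_pow_of_isHomogeneous hfh (hf.mul hh)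
    (by rw [hMi]; exact had)
  obtain ⟨w, hw, hwb, hwsum⟩ := exists_numD_univ_eq (i + 1) b
  rw [hbsum] at hwsum
  have hcoc : fracCochain f (i + 1) w ∈ Cech.cocycles (var f) n :=
    fracCochain_mem_cocycles hw hwsum
  have hdeg : (Submodule.Quotient.mk ⟨_, hcoc⟩ : H f n) ∈
      HDeg f n (((d + M - (i + 1) : ℕ) : ℤ) - (i + 1) * n) := by
    refine ⟨⟨_, hcoc⟩, fun I _ => ?_, rfl⟩
    refine ⟨i + 1, w I, ?_, ?_⟩
    · by_cases hI : I.card = n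
      · obtain ⟨l, rfl⟩ := compl_card_eq hI
        rw [hwb, hI]
        intro x hx
        have hx' : coeff x (b l) ≠ 0 := fun h0 => hx (by rw [coeff_smul, h0, smul_zero])
        have h1 := hb l hx'
        have h2 : Finsupp.weight (fun _ => (1 : ℤ)) x = ((Finsupp.weight 1 x : ℕ) : ℤ) := by
          rw [Finsupp.weight_apply, Finsupp.weight_apply, Finsupp.sum, Finsupp.sum]
          push_cast
          exact Finset.sum_congr rfl fun i _ => by simp
        rw [h2, h1]
        push_cast
        ring
      · rw [hw I hI]
        exact isWeightedHomogeneous_zero _ _ _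
    · rw [← locMap_xprod]
      exact frac_mul _ _ _
  have hHLE : (Submodule.Quotient.mk ⟨_, hcoc⟩ : H f n) ∈ HLE f n N := by
    refine Submodule.mem_iSup_of_mem (p := fun j : Set.Iic N => HDeg f n j) ⟨_, ?_⟩ hdeg
    -- With M = n i the degree of the class is d - i - (n+1), which is at most N by `ha`.
    rw [hMi, Set.mem_Iic, Nat.cast_sub had]
    push_cast
    linarith
  have hzero : (⟨_, hHLE⟩ : HLE f n N) = 0 := by
    refine (injective_iff_map_eq_zero _).mp hinj _ (Subtype.ext ?_)
    change Cech.frobH k p (var f) n (Submodule.Quotient.mk ⟨_, hcoc⟩) = 0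
    rw [frobH_mk_eq_zero_iff hφ hc hf0 hw hwsum]
    exact fun i => hh2 _ (Ideal.subset_span ⟨i, rfl⟩)
  have hzero' := congrArg Subtype.val hzero
  change (Submodule.Quotient.mk ⟨_, hcoc⟩ : H f n) = 0 at hzero'
  rw [mk_eq_zero_iff] at hzero'
  exact hh1 (mem_powIdeal_of_mem_coboundaries hf0 hwsum hzero')

end Hypersurface

/-! ### Comparison of the two conditions. -/

namespace Hypersurface

open MvPolynomial

set_option maxHeartbeats 1000000 in
/-- For a homogeneous hypersurface that is not F-pure at the origin, the non-F-pure point is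
isolated if and only if Frobenius is injective in degrees at most `-n (d - 1)`. -/
theorem hasIsolatedNonFPurePoint_iff_injective {k : Type u} [Field k] (p : ℕ) [Fact p.Prime] [CharP k p]
    (hk : (frobenius k p).Finite) (n d : ℕ) (f : MvPolynomial (Fin (n + 1)) k)
    (hf : f.IsHomogeneous d)
    (hm : ¬ IsFPure k p (LocAt f (maxIdeal k n))) :
    HasIsolatedNonFPurePoint p f ↔
      Function.Injective
        (frobeniusLE f p n (-((n : ℤ) * ((d : ℤ) - 1)))) := by
  have hp : p.Prime := Fact.out
  obtain ⟨ι, _, φ, c, hφ, hc, hdeg⟩ := exists_cartier_coordinates (σ := Fin (n + 1)) p hk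
  have hf0 : f ≠ 0 := by
    rintro rfl
    exact hm (isFPure_locAt_zero hφ hc _)
  set g : ι → MvPolynomial (Fin (n + 1)) k := fun i => φ i (f ^ (p - 1)) with hg
  have hJm : Ideal.span (Set.range g) ≤ maxIdeal k n := by
    rw [isFPure_locAt_iff hφ hc hf0] at hm
    exact not_not.mp hm
  have hgdeg : ∀ i, ∃ m, p * m ≤ d * (p - 1) ∧ (g i).IsHomogeneous m := fun i =>
    hdeg i _ _ (hf.pow (p - 1))
  -- If d ≤ 1, then p m ≤ d(p-1) < p makes all generators of J constant; lying in 𝔪 they vanish,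
  -- contradicting 0 ≠ f ∈ J.
  have hd2 : 2 ≤ d := by
    by_contra! hd
    have hg0 : ∀ i, g i = 0 := by
      intro i
      obtain ⟨m, hm1, hm2⟩ := hgdeg i
      have hp1 := hp.one_lt
      have hm0 : m = 0 := by
        by_contra hm0
        have h1 : p * 1 ≤ p * m := Nat.mul_le_mul_left p (by omega)
        have h2 : d * (p - 1) ≤ 1 * (p - 1) := Nat.mul_le_mul_right _ (by omega)
        omega
      subst hm0
      have h3 : g i ∈ idealOfVars (Fin (n + 1)) k ^ 1 := by
        rw [pow_one]
        exact hJm (Ideal.subset_span ⟨i, rfl⟩)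
      rw [mem_pow_idealOfVars_iff] at h3
      by_contra hne
      obtain ⟨x, hx⟩ := support_nonempty.mpr hne
      have h4 := h3 x hx
      rw [Finsupp.degree_eq_weight_one] at h4
      have h5 := hm2 (mem_support_iff.mp hx)
      change Finsupp.weight (fun _ => 1) x = 0 at h5
      omega
    have h6 := mem_span_range_cartier (f := f) hφ hc
    have h7 : Ideal.span (Set.range g) = ⊥ := by
      rw [Ideal.span_eq_bot]
      rintro _ ⟨i, rfl⟩
      exact hg0 i
    exact hf0 ((Submodule.mem_bot _).mp (h7 ▸ h6))
  have hgdeg' : ∀ i, ∃ m ≤ d - 1, (g i).IsHomogeneous m := by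
    intro i
    obtain ⟨m, hm1, hm2⟩ := hgdeg i
    refine ⟨m, ?_, hm2⟩
    have hp1 := hp.one_lt
    have h1 : d * (p - 1) < p * d := by
      rw [Nat.mul_sub, mul_one, mul_comm p d]
      have : d * 1 ≤ d * p := Nat.mul_le_mul_left d hp1.le
      omega
    have h2 := lt_of_mul_lt_mul_left (hm1.trans_lt h1) (Nat.zero_le p)
    omega
  have hiso : HasIsolatedNonFPurePoint p f ↔
      ∃ s, maxIdeal k n ^ s ≤ Ideal.span (Set.range g) := by
    rw [← forall_prime_lt_maxIdeal_iff ⟨_, rfl, by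
      rintro _ ⟨i, rfl⟩
      obtain ⟨m, -, h⟩ := hgdeg i
      exact ⟨m, h⟩⟩]
    constructor
    · rintro ⟨-, h⟩ P hP hlt
      exact (isFPure_locAt_iff hφ hc hf0 P).mp (h P hlt)
    · intro h
      exact ⟨hm, fun P hP hlt => (isFPure_locAt_iff hφ hc hf0 P).mpr (h P hlt)⟩
  -- With N = -n(D+1) the threshold d - N - (n+1) equals (n+1)D + 1, one more than the socle degree
  -- of n+1 forms of degree D + 1.
  obtain ⟨D, rfl⟩ : ∃ D, d = D + 2 := ⟨d - 2, by omega⟩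
  rw [hiso]
  constructor
  · rintro ⟨s, hs⟩
    refine injective_frobeniusLE hφ hc hf0 hf fun a ha => ?_
    refine monomial_mem_span_of_pow_le p (D := D + 1) (s := s) (by omega) hgdeg' hs ?_
    push_cast at ha
    zify
    push_cast
    nlinarith
  · intro hinj
    refine ⟨(n + 1) * D + 1, ?_⟩
    change idealOfVars (Fin (n + 1)) k ^ _ ≤ _
    rw [pow_idealOfVars_eq_span, Ideal.span_le]
    rintro _ ⟨a, ha : a.degree = _, rfl⟩
    refine monomial_mem_of_injective_frobeniusLE hφ hc hf0 hf
      (fun i => (hgdeg i).imp fun _ h => h.2) hinj ?_ ?_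
    · rw [ha]
      push_cast
      nlinarith
    · rw [ha]
      -- For n = 0 the inequality is an equality, D + 2 = d; for n ≥ 1 the term n|a| already absorbs
      -- |a|.
      rcases Nat.eq_zero_or_pos n with rfl | hn
      · simp
      · have : 1 * ((n + 1) * D + 1) ≤ n * ((n + 1) * D + 1) := Nat.mul_le_mul_right _ hn
        omega

end Hypersurface

theorem corollary2 {k : Type u} [Field k] (p : ℕ) [Fact p.Prime] [CharP k p]
    (hk : (frobenius k p).Finite) (n d : ℕ) (f : MvPolynomial (Fin (n + 1)) k)
    (hf : f.IsHomogeneous d)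
    (hm : ¬ IsFPure k p (Hypersurface.LocAt f (Hypersurface.maxIdeal k n))) :
    Hypersurface.HasIsolatedNonFPurePoint p f ↔
      Function.Injective
        (Hypersurface.frobeniusLE f p n (-((n : ℤ) * ((d : ℤ) - 1)))) :=
  Hypersurface.hasIsolatedNonFPurePoint_iff_injective p hk n d f hf hm
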